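/- Let $\mathfrak g$ be a finite-dimensional Lie algebra over a field $\mathbb K$ of characteristic $0$, and let $(\mathfrak g_n)_{n\ge 0}$ be its derivation tower: $\mathfrak g_0=\mathfrak g$ and $\mathfrak g_{n+1}=\operatorname{Der}\mathfrak g_n$. A Lie algebra is called complete if its center is zero and all its derivations are inner. The tower terminates at a Lie algebra $\widehat{\mathfrak g}$ if $\mathfrak g_n\cong\widehat{\mathfrak g}$ for all sufficiently large $n$. The tower is said to be - of type 1 if $Z(\mathfrak g_n)=0$ for all sufficiently large $n$ and the tower terminates at a complete Lie algebra; - of type 2 if $Z(\mathfrak g_n)\neq 0$ for all $n$ and the tower terminates at a Lie algebra $\widehat{\mathfrak g}$ that is the direct product $\mathbb K\times[\widehat{\mathfrak g},\widehat{\mathfrak g}]$ of a one-dimensional ideal and its derived ideal, where $[\widehat{\mathfrak g},\widehat{\mathfrak g}]$ is perfect (equal to its own derived ideal) and complete; - of type 3 if the sequence of dimensions $\dim\mathfrak g_n$ is non-decreasing and tends to infinity. Suppose that for some $p\ge 0$ the radical of $\mathfrak g_p$ (its largest solvable ideal) is not nilpotent. Then for every $n\ge p$ the radical of $\mathfrak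 g_n$ is not nilpotent, and the tower is of type 1 or of type 3 (and not of type 2). If it is of type 3, then the dimensions increase strictly from $\mathfrak g_p$ on: $\dim\mathfrak g_n<\dim\mathfrak g_{n+1}$ for all $n\ge p$. -/

import Mathlib

universe u v

/-- A Lie algebra over `K`, bundled with its carrier, so that the derivation tower, whose carriers
change from one step to the next, is a sequence of terms of one type. -/
structure BundledLieAlgebra (K : Type u) [Field K] : Type (max u (v + 1)) where
  carrier : Type v
  [lieRing : LieRing carrier]
  [lieAlgebra : LieAlgebra K carrier]

attribute [instance] BundledLieAlgebra.lieRing BundledLieAlgebra.lieAlgebra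

/-- The derivation tower of `g`, as bundled Lie algebras: `g₀ = g` and `gₙ₊₁ = Der gₙ`. -/
def derivationTowerBundled (K : Type u) [Field K] (g : Type v) [LieRing g] [LieAlgebra K g] :
    ℕ → BundledLieAlgebra.{u, v} K
  | 0 => ⟨g⟩
  | n + 1 => ⟨LieDerivation K (derivationTowerBundled K g n).carrier
      (derivationTowerBundled K g n).carrier⟩

/-- The `n`-th algebra `gₙ` of the derivation tower of `g`. -/
abbrev DerivationTower (K : Type u) [Field K] (g : Type v) [LieRing g] [LieAlgebra K g] (n : ℕ) :
    Type v :=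
  (derivationTowerBundled K g n).carrier

/-- The radical (the largest solvable ideal) is not nilpotent as a Lie algebra. -/
def HasNonNilpotentRadical (K : Type u) [Field K] (L : Type v) [LieRing L] [LieAlgebra K L] :
    Prop :=
  ¬ LieRing.IsNilpotent (LieAlgebra.radical K L)

/-- A Lie algebra is complete if its center is trivial and all its derivations are inner. -/
def IsCompleteLieAlgebra (K : Type u) [Field K] (L : Type v) [LieRing L] [LieAlgebra K L] :
    Prop :=
  LieAlgebra.center K L = ⊥ ∧ ∀ D : LieDerivation K L L, ∃ x : L, D = LieDerivation.ad K L x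

/-- The derived ideal `[L, L]`. -/
abbrev derivedIdeal (K : Type u) [Field K] (L : Type v) [LieRing L] [LieAlgebra K L] :
    LieIdeal K L :=
  LieAlgebra.derivedSeries K L 1

/-- A Lie algebra is perfect if it equals its derived ideal. -/
def IsPerfectLieAlgebra (K : Type u) [Field K] (L : Type v) [LieRing L] [LieAlgebra K L] :
    Prop :=
  derivedIdeal K L = ⊤

/-- The tower of `g` terminates at `L`: from some index on, every `gₙ` is isomorphic to `L`. -/
def TowerTerminatesAt (K : Type u) [Field K] (g : Type v) [LieRing g] [LieAlgebra K g]
    (L : Type v) [LieRing L] [LieAlgebra K L] : Prop :=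
  ∃ N : ℕ, ∀ n ≥ N, Nonempty (DerivationTower K g n ≃ₗ⁅K⁆ L)

/-- Type 1: the center of `gₙ` is trivial for all large `n`, and the tower terminates at a complete
Lie algebra. -/
def IsTowerOfType1 (K : Type u) [Field K] (g : Type v) [LieRing g] [LieAlgebra K g] : Prop :=
  (∃ N : ℕ, ∀ n ≥ N, LieAlgebra.center K (DerivationTower K g n) = ⊥) ∧
  ∃ L : BundledLieAlgebra.{u, v} K,
    TowerTerminatesAt K g L.carrier ∧ IsCompleteLieAlgebra K L.carrier

/-- Type 2: the center of `gₙ` is nonzero for all `n`, and the tower terminates at a Lie algebra `L`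
which is the direct product of a one-dimensional ideal and of `[L, L]`, the latter being a perfect
and complete Lie algebra. -/
def IsTowerOfType2 (K : Type u) [Field K] (g : Type v) [LieRing g] [LieAlgebra K g] : Prop :=
  (∀ n : ℕ, LieAlgebra.center K (DerivationTower K g n) ≠ ⊥) ∧
  ∃ L : BundledLieAlgebra.{u, v} K,
    TowerTerminatesAt K g L.carrier ∧
    (∃ I : LieIdeal K L.carrier,
      Module.finrank K I = 1 ∧ IsCompl I (derivedIdeal K L.carrier)) ∧
    IsPerfectLieAlgebra K (derivedIdeal K L.carrier) ∧
    IsCompleteLieAlgebra K (derivedIdeal K L.carrier)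

/-- Type 3: the sequence of the dimensions of the `gₙ` increases (in the wide sense) and diverges. -/
def IsTowerOfType3 (K : Type u) [Field K] (g : Type v) [LieRing g] [LieAlgebra K g] : Prop :=
  Monotone (fun n : ℕ => Module.finrank K (DerivationTower K g n)) ∧
  Filter.Tendsto (fun n : ℕ => Module.finrank K (DerivationTower K g n)) Filter.atTop Filter.atTop

/-! The tower splits into two cases: some center vanishes, or none does.

If `Z(gₙ) = 0`, iterated adjoint maps embed `gₙ` in every later algebra as a subnormal subalgebra
with trivial centralizer. By Schenkman's argument
(`LieSubalgebra.IsSubnormalCentralizing.finrank_le`) such a subalgebra of dimension `d` bounds the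
ambient dimension by `d² + d`. From `gₙ` on, the centers vanish, the dimensions grow and are
bounded, so some adjoint map is bijective: type 1.

If no center vanishes, no `gₙ` is perfect, since a perfect algebra has a centerless derivation
algebra. For non-perfect `L`, take a functional `f` killing brackets and let `C` be the centralizer
of `ker f`. The derivations `u ↦ f u • c`, `c ∈ C`, make up for what `ad` loses, so the dimension
does not drop.

Non-nilpotency of the radical is inherited: in characteristic 0 derivations preserve the radical, so
`ad` maps it onto a solvable ideal of `Der L`. It also makes the growth strict. If `dim Der L ≤ dim
L` and `Z(L) ≠ 0`, then `[L, L] = ker f` and `Der L` is spanned by inner derivations and derivations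
killing `ker f`. A radical element that is not ad-nilpotent then yields `y` with `f y = 1` and `ad
y` semisimple. Consequently `Der L = Z(Der L) ⊕ ad L`, and `Der (Der L)` is centerless, which is
excluded. So the dimensions tend to infinity: type 3. Towers of type 1 or 2 terminate, hence have
bounded dimensions. -/

open LieAlgebra LieModule Module

/-! ### Ad-nilpotency of radical elements in the derived ideal. -/

/-- Elements of the radical lying in the derived ideal act nilpotently on finite-dimensional
modules (algebraically closed case). -/
theorem isNilpotent_toEnd_of_mem_radical_of_mem_derivedSeries_of_isAlgClosed
    {k L : Type*} [Field k] [CharZero k] [IsAlgClosed k]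
    [LieRing L] [LieAlgebra k L] [FiniteDimensional k L] {x : L}
    (hR : x ∈ radical k L) (hD : x ∈ derivedSeries k L 1) (n : ℕ) :
    ∀ (M : Type v) [AddCommGroup M] [Module k M] [LieRingModule L M] [LieModule k L M]
      [FiniteDimensional k M], finrank k M ≤ n → IsNilpotent (toEnd k L M x) := by
  have htr : ∀ (M : Type v) [AddCommGroup M] [Module k M] [LieRingModule L M] [LieModule k L M],
      LinearMap.trace k M (toEnd k L M x) = 0 := by
    intro M _ _ _ _
    rw [derivedSeries_def, derivedSeriesOfIdeal_succ, derivedSeriesOfIdeal_zero] at hD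
    clear hR
    induction hD using LieSubmodule.lieSpan_induction with
    | mem y hy =>
      obtain ⟨a, b, rfl⟩ := hy
      simp [LieHom.map_lie]
    | zero => simp
    | add => simp_all
    | smul => simp_all
    | lie => simp [LieHom.map_lie]
  induction n with
  | zero =>
    intro M _ _ _ _ _ hM
    have : Subsingleton M := (finrank_zero_iff (R := k)).mp (by omega)
    exact ⟨1, by ext m; exact Subsingleton.elim _ _⟩
  | succ n ih =>
    intro M _ _ _ _ _ hM
    rcases subsingleton_or_nontrivial M with h | h
    · exact ⟨1, by ext m; exact Subsingleton.elim _ _⟩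
    -- By Lie's theorem the radical has a weight space, which is `L`-stable in characteristic 0.
    -- There `x` acts as the scalar `χ x`, and trace zero forces this scalar to vanish; induction
    -- handles the quotient.
    obtain ⟨χ, hχ⟩ : ∃ χ : Module.Dual k (radical k L), Nontrivial (weightSpace M χ) :=
      exists_nontrivial_weightSpace_of_isSolvable k (radical k L) M
    let N : LieSubmodule k L M := weightSpaceOfIsLieTower k M χ
    have hN : Nontrivial N := hχ
    have hNx (m : M) (hm : m ∈ N) : ⁅x, m⁆ = χ ⟨x, hR⟩ • m := by
      have : ∀ (y : L) (hy : y ∈ radical k L), ⁅y, m⁆ = χ ⟨y, hy⟩ • m := by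
        simpa [N, weightSpaceOfIsLieTower, mem_weightSpace] using hm
      exact this x hR
    have hend : toEnd k L N x = χ ⟨x, hR⟩ • LinearMap.id := by
      ext m
      simpa using hNx m m.2
    have h0 : χ ⟨x, hR⟩ = 0 := by
      have := htr N
      rw [hend, map_smul, LinearMap.trace_id, smul_eq_mul, mul_eq_zero] at this
      refine this.resolve_right ?_
      have : 0 < finrank k N := finrank_pos
      exact_mod_cast this.ne'
    have hq : finrank k (M ⧸ N) ≤ n := by
      have h1 := N.toSubmodule.finrank_quotient_add_finrank
      have h2 : 0 < finrank k N := finrank_pos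
      have h3 : finrank k (M ⧸ N) = finrank k (M ⧸ N.toSubmodule) := rfl
      have h4 : finrank k N = finrank k N.toSubmodule := rfl
      omega
    obtain ⟨r, hr⟩ := ih (M ⧸ N) hq
    refine ⟨r + 1, ?_⟩
    ext m
    have hmem : (toEnd k L M x ^ r) m ∈ N := by
      rw [← LieSubmodule.Quotient.mk_eq_zero']
      have : ∀ j, ((LieSubmodule.Quotient.mk ((toEnd k L M x ^ j) m) : M ⧸ N)) =
          (toEnd k L (M ⧸ N) x ^ j) (LieSubmodule.Quotient.mk m) := by
        intro j
        induction j with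
        | zero => simp
        | succ j ihj =>
          rw [pow_succ', pow_succ', Module.End.mul_apply, Module.End.mul_apply, ← ihj]
          rfl
      rw [this, hr]
      rfl
    rw [pow_succ', Module.End.mul_apply, toEnd_apply_apply, hNx _ hmem, h0, zero_smul]
    rfl

/-- Elements of the radical lying in the derived ideal are ad-nilpotent. -/
theorem isNilpotent_ad_of_mem_radical_of_mem_derivedSeries
    {K L : Type*} [Field K] [CharZero K] [LieRing L] [LieAlgebra K L] [FiniteDimensional K L]
    {x : L} (hR : x ∈ radical K L) (hD : x ∈ derivedSeries K L 1) :
    IsNilpotent (ad K L x) := by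
  let A := AlgebraicClosure K
  have hR' : (1 : A) ⊗ₜ[K] x ∈ radical A (TensorProduct K A L) := by
    have : IsSolvable ((radical K L).baseChange A) := by
      obtain ⟨k, hk⟩ := IsSolvable.solvable K (radical K L)
      rw [LieIdeal.derivedSeries_eq_bot_iff] at hk
      refine IsSolvable.mk (R := A) (k := k) ?_
      rw [LieIdeal.derivedSeries_eq_bot_iff, derivedSeriesOfIdeal_baseChange, hk,
        LieSubmodule.baseChange_bot]
    exact (LieIdeal.solvable_iff_le_radical A _ _).mp this
      (LieSubmodule.tmul_mem_baseChange_of_mem 1 hR)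
  have hD' : (1 : A) ⊗ₜ[K] x ∈ derivedSeries A (TensorProduct K A L) 1 := by
    rw [derivedSeries_baseChange]
    exact Submodule.tmul_mem_baseChange_of_mem 1 hD
  have := isNilpotent_toEnd_of_mem_radical_of_mem_derivedSeries_of_isAlgClosed hR' hD' _
    (TensorProduct K A L) le_rfl
  have hinj : Function.Injective (Module.End.baseChangeHom K A L) :=
    LinearMap.baseChangeHom_injective K L A
  have aux : (toEnd K L L x).baseChange A = (ad K L x).baseChangeHom K A L := rfl
  rw [← IsNilpotent.map_iff hinj, ← aux, ← toEnd_baseChange]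
  exact this

/-! ### Detecting a non-nilpotent radical. -/

section

variable {K : Type u} {L : Type v} [Field K] [LieRing L] [LieAlgebra K L] [FiniteDimensional K L]

/-- The radical is not nilpotent iff it contains an element which is not ad-nilpotent. -/
theorem hasNonNilpotentRadical_iff :
    HasNonNilpotentRadical K L ↔ ∃ x ∈ radical K L, ¬ IsNilpotent (ad K L x) := by
  rw [HasNonNilpotentRadical, LieAlgebra.isNilpotent_iff_forall (R := K)]
  constructor
  · contrapose!
    rintro h ⟨x, hx⟩
    exact LieSubalgebra.isNilpotent_ad_of_isNilpotent_ad (radical K L : LieSubalgebra K L)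
      (x := ⟨x, hx⟩) (h x hx)
  · rintro ⟨x, hx, hnil⟩ h
    obtain ⟨k, hk⟩ := h ⟨x, hx⟩
    -- The extra factor carries `L` into the radical, where the `k`-th power vanishes.
    refine hnil ⟨k + 1, ?_⟩
    have key (j : ℕ) (r : radical K L) :
        ((ad K L x) ^ j) (r : L) = ((ad K (radical K L) ⟨x, hx⟩ ^ j) r : radical K L) := by
      induction j with
      | zero => simp
      | succ j ih =>
        rw [pow_succ', pow_succ', Module.End.mul_apply, Module.End.mul_apply, ih]
        rfl
    ext u
    have hu : ⁅x, u⁆ ∈ radical K L := lie_mem_left K L _ _ _ hx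
    rw [pow_succ, Module.End.mul_apply, ad_apply, key k ⟨_, hu⟩, hk]
    rfl

/-- An element whose brackets all lie in the radical is in the radical. -/
theorem normalizer_radical_le : (radical K L).normalizer ≤ radical K L := by
  rw [← LieIdeal.solvable_iff_le_radical]
  obtain ⟨k, hk⟩ := IsSolvable.solvable K (radical K L)
  rw [LieIdeal.derivedSeries_eq_bot_iff] at hk
  refine IsSolvable.mk (R := K) (k := k + 1) ?_
  rw [LieIdeal.derivedSeries_eq_bot_iff, derivedSeriesOfIdeal_add, eq_bot_iff, ← hk]
  refine derivedSeriesOfIdeal_mono ?_ k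
  rw [derivedSeriesOfIdeal_succ, derivedSeriesOfIdeal_zero, LieSubmodule.lie_le_iff]
  intro a _ b hb
  exact (LieSubmodule.mem_normalizer _ _).mp hb a

end

/-! ### Stability of the radical under derivations. -/

section

variable {K : Type u} {L : Type v} [Field K] [LieRing L] [LieAlgebra K L]

/-- Iterates of a derivation of order less than `2 ^ k` send the `k`-th derived ideal of an ideal `I`
to `I`. -/
theorem LieDerivation.iterate_mem_of_mem_derivedSeriesOfIdeal (D : LieDerivation K L L)
    (I : LieIdeal K L) (k : ℕ) {r : L} (hr : r ∈ derivedSeriesOfIdeal K L k I) :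
    ∀ j < 2 ^ k, D^[j] r ∈ I := by
  have hlin (j : ℕ) : D^[j] = ⇑((D : L →ₗ[K] L) ^ j) := by
    rw [Module.End.coe_pow]; rfl
  induction k generalizing r with
  | zero =>
    intro j hj
    obtain rfl : j = 0 := by simpa using hj
    simpa using hr
  | succ k ih =>
    intro j hj
    rw [derivedSeriesOfIdeal_succ] at hr
    rw [← LieSubmodule.mem_toSubmodule, LieSubmodule.lieIdeal_oper_eq_linear_span'] at hr
    induction hr using Submodule.span_induction with
    | mem y hy =>
      obtain ⟨a, ha, b, hb, rfl⟩ := hy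
      rw [D.iterate_apply_lie]
      refine sum_mem fun ij hij => nsmul_mem ?_ _
      rw [Finset.HasAntidiagonal.mem_antidiagonal] at hij
      rw [pow_succ] at hj
      rcases lt_or_ge ij.1 (2 ^ k) with h | h
      · exact lie_mem_left K L _ _ _ (ih ha _ h)
      · exact lie_mem_right K L _ _ _ (ih hb _ (by omega))
    | zero => simp
    | add a b _ _ ha hb => rw [hlin, map_add, ← hlin]; exact add_mem ha hb
    | smul c a _ ha => rw [hlin, map_smul, ← hlin]; exact SMulMemClass.smul_mem c ha

/-- The ideal `I + D I` for a derivation `D` and an ideal `I`. -/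
def LieDerivation.supMap (D : LieDerivation K L L) (I : LieIdeal K L) : LieIdeal K L where
  toSubmodule := I.toSubmodule ⊔ I.toSubmodule.map (D : L →ₗ[K] L)
  lie_mem {u x} hx := by
    simp only [AddSubsemigroup.mem_carrier, AddSubmonoid.mem_toSubsemigroup,
      Submodule.mem_toAddSubmonoid, Submodule.mem_sup, Submodule.mem_map] at hx ⊢
    obtain ⟨a, ha, _, ⟨b, hb, rfl⟩, rfl⟩ := hx
    refine ⟨⁅u, a⁆ - ⁅D u, b⁆, sub_mem (lie_mem_right K L I u a ha) (lie_mem_right K L I _ b hb),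
      D ⁅u, b⁆, ⟨⁅u, b⁆, lie_mem_right K L I u b hb, rfl⟩, ?_⟩
    rw [D.apply_lie_eq_add]
    simp

theorem LieDerivation.mem_supMap {D : LieDerivation K L L} {I : LieIdeal K L} {x : L} :
    x ∈ D.supMap I ↔ ∃ r ∈ I, x - D r ∈ I := by
  change x ∈ I.toSubmodule ⊔ I.toSubmodule.map (D : L →ₗ[K] L) ↔ _
  simp only [Submodule.mem_sup, Submodule.mem_map]
  constructor
  · rintro ⟨a, ha, _, ⟨b, hb, rfl⟩, rfl⟩
    exact ⟨b, hb, by simpa using ha⟩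
  · rintro ⟨r, hr, h⟩
    exact ⟨_, h, _, ⟨r, hr, rfl⟩, by simp⟩

/-- Modulo `I`, the `k`-th derived ideal of `I + D I` is contained in the image under `D ^ (2 ^ k)`
of the `k`-th derived ideal of `I`. -/
theorem LieDerivation.exists_sub_iterate_mem [CharZero K] (D : LieDerivation K L L) (I : LieIdeal K L) (k : ℕ)
    {x : L} (hx : x ∈ derivedSeriesOfIdeal K L k (D.supMap I)) :
    ∃ r ∈ derivedSeriesOfIdeal K L k I, x - D^[2 ^ k] r ∈ I := by
  have hlin (j : ℕ) : D^[j] = ⇑((D : L →ₗ[K] L) ^ j) := by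
    rw [Module.End.coe_pow]; rfl
  induction k generalizing x with
  | zero => simpa using LieDerivation.mem_supMap.mp hx
  | succ k ih =>
    rw [derivedSeriesOfIdeal_succ] at hx
    rw [← LieSubmodule.mem_toSubmodule, LieSubmodule.lieIdeal_oper_eq_linear_span'] at hx
    induction hx using Submodule.span_induction with
    | mem y hy =>
      obtain ⟨a, ha, b, hb, rfl⟩ := hy
      obtain ⟨r, hr, har⟩ := ih ha
      obtain ⟨s, hs, hbs⟩ := ih hb
      set m := 2 ^ k with hm
      have hpow : 2 ^ (k + 1) = m + m := by rw [hm]; ring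
      -- Modulo `I`, only the middle term of the Leibniz expansion of `D^[2m] ⁅r, s⁆` survives,
      -- since in any other term one factor is differentiated fewer than `m` times. Its coefficient
      -- is invertible in characteristic 0.
      set c : K := ((m + m).choose m : K) with hc
      have hc0 : c ≠ 0 := by
        rw [hc]; exact_mod_cast (Nat.choose_pos (Nat.le_add_left m m)).ne'
      have hrs : ⁅r, s⁆ ∈ derivedSeriesOfIdeal K L (k + 1) I := by
        rw [derivedSeriesOfIdeal_succ]
        exact LieSubmodule.lie_mem_lie hr hs
      refine ⟨c⁻¹ • ⁅r, s⁆, SMulMemClass.smul_mem _ hrs, ?_⟩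
      have h1 : D^[m + m] ⁅r, s⁆ - c • ⁅D^[m] r, D^[m] s⁆ ∈ I := by
        rw [D.iterate_apply_lie, ← Finset.add_sum_erase _ _
          (Finset.HasAntidiagonal.mem_antidiagonal.mpr rfl : (m, m) ∈ Finset.HasAntidiagonal.antidiagonal (m + m))]
        rw [hc, Nat.cast_smul_eq_nsmul, add_sub_cancel_left]
        refine sum_mem fun ij hij => nsmul_mem ?_ _
        rw [Finset.mem_erase, Finset.HasAntidiagonal.mem_antidiagonal] at hij
        rcases lt_or_ge ij.1 m with h | h
        · exact lie_mem_left K L _ _ _ (D.iterate_mem_of_mem_derivedSeriesOfIdeal I k hr _ h)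
        · refine lie_mem_right K L _ _ _ (D.iterate_mem_of_mem_derivedSeriesOfIdeal I k hs _ ?_)
          have : ij.1 ≠ m := fun h' => hij.1 (Prod.ext h' (by simp; omega))
          omega
      have h2 : ⁅a, b⁆ - ⁅D^[m] r, D^[m] s⁆ ∈ I := by
        have : ⁅a, b⁆ - ⁅D^[m] r, D^[m] s⁆ =
            ⁅a - D^[m] r, b⁆ + ⁅D^[m] r, b - D^[m] s⁆ := by simp
        rw [this]
        exact add_mem (lie_mem_left K L _ _ _ har) (lie_mem_right K L _ _ _ hbs)
      have h3 : ⁅a, b⁆ - D^[m + m] (c⁻¹ • ⁅r, s⁆) = (⁅a, b⁆ - ⁅D^[m] r, D^[m] s⁆) -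
          c⁻¹ • (D^[m + m] ⁅r, s⁆ - c • ⁅D^[m] r, D^[m] s⁆) := by
        rw [hlin (m + m), map_smul, smul_sub, smul_smul, inv_mul_cancel₀ hc0, one_smul]
        abel
      rw [hpow, h3]
      exact sub_mem h2 (SMulMemClass.smul_mem _ h1)
    | zero => exact ⟨0, zero_mem _, by simp⟩
    | add a b _ _ ha hb =>
      obtain ⟨r, hr, har⟩ := ha
      obtain ⟨s, hs, hbs⟩ := hb
      refine ⟨r + s, add_mem hr hs, ?_⟩
      rw [hlin, map_add, ← hlin, add_sub_add_comm]
      exact add_mem har hbs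
    | smul c a _ ha =>
      obtain ⟨r, hr, har⟩ := ha
      refine ⟨c • r, SMulMemClass.smul_mem c hr, ?_⟩
      rw [hlin, map_smul, ← hlin, ← smul_sub]
      exact SMulMemClass.smul_mem c har

/-- In characteristic zero the radical is stable under all derivations. -/
theorem LieDerivation.apply_mem_radical [CharZero K] [FiniteDimensional K L] (D : LieDerivation K L L) {x : L}
    (hx : x ∈ radical K L) : D x ∈ radical K L := by
  obtain ⟨k, hk⟩ := IsSolvable.solvable K (radical K L)
  rw [LieIdeal.derivedSeries_eq_bot_iff] at hk
  have hle : derivedSeriesOfIdeal K L k (D.supMap (radical K L)) ≤ radical K L := by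
    intro y hy
    obtain ⟨r, hr, h⟩ := D.exists_sub_iterate_mem _ k hy
    rw [hk, LieSubmodule.mem_bot] at hr
    have h0 : D^[2 ^ k] r = 0 := by
      rw [hr]; exact Function.iterate_fixed (map_zero D) _
    simpa [h0] using h
  have hsol : IsSolvable (D.supMap (radical K L)) := by
    refine IsSolvable.mk (R := K) (k := k + k) ?_
    rw [LieIdeal.derivedSeries_eq_bot_iff, derivedSeriesOfIdeal_add, eq_bot_iff, ← hk]
    exact derivedSeriesOfIdeal_mono hle k
  exact (LieIdeal.solvable_iff_le_radical K L _).mp hsol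
    (LieDerivation.mem_supMap.mpr ⟨x, hx, by simp⟩)

/-- If the radical of `L` is not nilpotent, then neither is that of its derivation algebra. -/
theorem HasNonNilpotentRadical.lieDerivation [CharZero K] [FiniteDimensional K L]
    (h : HasNonNilpotentRadical K L) : HasNonNilpotentRadical K (LieDerivation K L L) := by
  rw [hasNonNilpotentRadical_iff] at h ⊢
  obtain ⟨x, hx, hnil⟩ := h
  refine ⟨LieDerivation.ad K L x, ?_, ?_⟩
  · let I : LieIdeal K (LieDerivation K L L) :=
      { toSubmodule := (radical K L).toSubmodule.map (LieDerivation.ad K L : L →ₗ[K] _)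
        lie_mem := by
          rintro D _ ⟨y, hy, rfl⟩
          exact ⟨D y, D.apply_mem_radical hy, (LieDerivation.lie_der_ad_eq_ad_der D y).symm⟩ }
    have hI : IsSolvable I := by
      let f : radical K L →ₗ⁅K⁆ I :=
        { toFun := fun y => ⟨LieDerivation.ad K L y, y, y.2, rfl⟩
          map_add' := fun a b => Subtype.ext (by simp)
          map_smul' := fun c a => Subtype.ext (by simp)
          map_lie' := fun {a b} => Subtype.ext (by simp) }
      refine Function.Surjective.lieAlgebra_isSolvable (f := f) ?_
      rintro ⟨_, y, hy, rfl⟩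
      exact ⟨⟨y, hy⟩, rfl⟩
    exact (LieIdeal.solvable_iff_le_radical K _ I).mp hI ⟨x, hx, rfl⟩
  · rintro ⟨k, hk⟩
    -- The `k`-th power only makes `(ad x)^k u` central; bracketing it with `x` costs one more step.
    refine hnil ⟨k + 1, ?_⟩
    have key (j : ℕ) (u : L) : (ad K _ (LieDerivation.ad K L x) ^ j) (LieDerivation.ad K L u) =
        LieDerivation.ad K L ((ad K L x ^ j) u) := by
      induction j with
      | zero => simp
      | succ j ih =>
        rw [pow_succ', pow_succ', Module.End.mul_apply, Module.End.mul_apply, ih, ad_apply,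
          ad_apply, LieHom.map_lie]
    ext u
    have h0 := key k u
    rw [hk, LinearMap.zero_apply] at h0
    have : ⁅(ad K L x ^ k) u, x⁆ = 0 := by simpa using LieDerivation.congr_fun h0.symm x
    rw [pow_succ', Module.End.mul_apply, ad_apply, ← lie_skew, this, neg_zero]
    rfl

end

/-! ### Invariants and coinvariants under nilpotent actions. -/

section

variable {K L M : Type*} [Field K] [LieRing L] [LieAlgebra K L]
  [AddCommGroup M] [Module K M] [LieRingModule L M] [LieModule K L M] [FiniteDimensional K M]

/-- A finite-dimensional module over a nilpotent Lie algebra has no nonzero invariants iff it has no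
nonzero coinvariants. -/
theorem maxTrivSubmodule_eq_bot_iff_of_isNilpotent [LieRing.IsNilpotent L] :
    maxTrivSubmodule K L M = ⊥ ↔ lowerCentralSeries K L M 1 = ⊤ := by
  -- Fitting decomposition: both conditions say that the generalized weight space of weight 0
  -- vanishes.
  have hc := isCompl_genWeightSpace_zero_posFittingComp K L M
  constructor
  · intro h
    have h0 : genWeightSpace M (0 : L → K) = ⊥ := by
      by_contra hne
      have : Nontrivial (genWeightSpace M (0 : L → K)) :=
        (LieSubmodule.nontrivial_iff_ne_bot K L M).mpr hne
      have := nontrivial_max_triv_of_isNilpotent K L (genWeightSpace M (0 : L → K))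
      obtain ⟨⟨⟨m, hm⟩, hm'⟩, hne'⟩ := exists_ne
        (0 : maxTrivSubmodule K L (genWeightSpace M (0 : L → K)))
      rw [mem_maxTrivSubmodule] at hm'
      have : m ∈ maxTrivSubmodule K L M := by
        rw [mem_maxTrivSubmodule]
        exact fun x => congrArg Subtype.val (hm' x)
      rw [h, LieSubmodule.mem_bot] at this
      exact hne' (Subtype.ext (Subtype.ext this))
    rw [h0] at hc
    rw [eq_top_iff, ← eq_top_of_bot_isCompl hc]
    exact (posFittingComp_le_iInf_lowerCentralSeries K L M).trans (iInf_le _ 1)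
  · intro h
    have hlcs (k : ℕ) : lowerCentralSeries K L M k = ⊤ := by
      induction k with
      | zero => simp
      | succ k ih =>
        rw [LieModule.lowerCentralSeries_succ, ih]
        simpa using h
    have h1 : posFittingComp K L M = ⊤ := by
      rw [← iInf_lowerCentralSeries_eq_posFittingComp]
      simp [hlcs]
    rw [h1] at hc
    rw [eq_bot_iff, ← eq_bot_of_isCompl_top hc]
    intro m hm
    rw [mem_maxTrivSubmodule] at hm
    rw [mem_genWeightSpace]
    exact fun x => ⟨1, by simpa using hm x⟩

attribute [local instance] LieRing.ofAssociativeRing in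
/-- A finite-dimensional module on which some term of the lower central series acts trivially has
no nonzero invariants iff it has no nonzero coinvariants. -/
theorem maxTrivSubmodule_eq_bot_iff {k : ℕ}
    (hk : ∀ x ∈ lowerCentralSeries K L L k, ∀ m : M, ⁅x, m⁆ = 0) :
    maxTrivSubmodule K L M = ⊥ ↔ lowerCentralSeries K L M 1 = ⊤ := by
  -- The action factors through its image in `End M`, which is nilpotent by `hk`.
  have hnil : LieRing.IsNilpotent (toEnd K L M).range := by
    rw [LieRing.IsNilpotent, LieModule.isNilpotent_iff K]
    refine ⟨k, ?_⟩
    rw [← LieIdeal.lowerCentralSeries_map_eq k (toEnd K L M).surjective_rangeRestrict,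
      LieIdeal.map_eq_bot_iff]
    intro x hx
    rw [LieHom.mem_ker]
    ext m
    exact hk x hx m
  have h1 : maxTrivSubmodule K (toEnd K L M).range M = ⊥ ↔ maxTrivSubmodule K L M = ⊥ := by
    simp only [LieSubmodule.eq_bot_iff, mem_maxTrivSubmodule]
    refine forall_congr' fun m => imp_congr_left ⟨fun h x => h ⟨_, x, rfl⟩, ?_⟩
    rintro h ⟨_, x, rfl⟩
    exact h x
  rw [← h1, maxTrivSubmodule_eq_bot_iff_of_isNilpotent, ← LieSubmodule.toSubmodule_inj,
    coe_lcs_range_toEnd_eq, ← LieSubmodule.toSubmodule_inj (lowerCentralSeries K L M 1)]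
  rfl

end

/-! ### Subnormal subalgebras with trivial centralizer. -/

section

variable {K : Type u} {L : Type v} [Field K] [LieRing L] [LieAlgebra K L]

/-- A subalgebra with trivial centralizer which is, in a module-theoretic sense, subnormal. -/
structure LieSubalgebra.IsSubnormalCentralizing (H : LieSubalgebra K L) : Prop where
  eq_zero_of_forall_lie : ∀ y : L, (∀ h ∈ H, ⁅h, y⁆ = 0) → y = 0
  exists_lcs_le : ∃ k, (lowerCentralSeries K H L k).toSubmodule ≤ H.toSubmodule

theorem LieSubalgebra.isSubnormalCentralizing_top (h : center K L = ⊥) :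
    (⊤ : LieSubalgebra K L).IsSubnormalCentralizing where
  eq_zero_of_forall_lie y hy := by
    rw [← LieSubmodule.mem_bot (R := K) (L := L), ← h, mem_maxTrivSubmodule]
    exact fun x => hy x trivial
  exists_lcs_le := ⟨0, le_top⟩

theorem LieSubalgebra.IsSubnormalCentralizing.center_eq_bot {H : LieSubalgebra K L}
    (hH : H.IsSubnormalCentralizing) : center K L = ⊥ := by
  rw [LieSubmodule.eq_bot_iff]
  intro y hy
  rw [mem_maxTrivSubmodule] at hy
  exact hH.eq_zero_of_forall_lie y fun h _ => hy h

/-- A derivation `D` commuting with `ad H` kills `H`, because `ad` is injective, so it commutes with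
the action of `H` on `L`. Going back up the series from the term inside `H`, `⁅h, D x⁆ = D ⁅h, x⁆ =
0` for all `h ∈ H` gives `D x = 0`. Subnormality takes one step more than for `H`: `⁅ad h, D⁆ = -ad
(D h)` first brings `Der L` into `ad L`. -/
theorem LieSubalgebra.IsSubnormalCentralizing.map_ad {H : LieSubalgebra K L}
    (hH : H.IsSubnormalCentralizing) :
    (H.map (LieDerivation.ad K L)).IsSubnormalCentralizing := by
  have hinj := LieDerivation.injective_ad_of_center_eq_bot hH.center_eq_bot
  obtain ⟨k, hk⟩ := hH.exists_lcs_le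
  constructor
  · intro D hD
    have hDh (h : L) (hh : h ∈ H) : D h = 0 := by
      have := hD _ ⟨h, hh, rfl⟩
      rw [← lie_skew, neg_eq_zero] at this
      refine hinj ?_
      rw [map_zero, ← LieDerivation.lie_der_ad_eq_ad_der]
      exact this
    have hcomm (h : L) (hh : h ∈ H) (x : L) : D ⁅h, x⁆ = ⁅h, D x⁆ := by
      rw [D.apply_lie_eq_add, hDh h hh, zero_lie, add_zero]
    have hkill (i j : ℕ) (hij : i + j = k) (x : L) (hx : x ∈ lowerCentralSeries K H L i) :
        D x = 0 := by
      induction j generalizing i x with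
      | zero =>
        obtain rfl : i = k := by simpa using hij
        exact hDh x (hk hx)
      | succ j ih =>
        refine hH.eq_zero_of_forall_lie _ fun h hh => ?_
        rw [← hcomm h hh]
        refine ih (i + 1) (by omega) _ ?_
        rw [LieModule.lowerCentralSeries_succ]
        exact LieSubmodule.lie_mem_lie (LieSubmodule.mem_top (⟨h, hh⟩ : H)) hx
    ext x
    exact hkill 0 k (by omega) x (by simp)
  · refine ⟨k + 1, ?_⟩
    have key (j : ℕ) :
        (lowerCentralSeries K (H.map (LieDerivation.ad K L)) (LieDerivation K L L) (j + 1)).toSubmodule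
          ≤ (lowerCentralSeries K H L j).toSubmodule.map
            (LieDerivation.ad K L : L →ₗ[K] LieDerivation K L L) := by
      induction j with
      | zero =>
        rw [LieModule.lowerCentralSeries_succ, LieSubmodule.lieIdeal_oper_eq_linear_span', Submodule.span_le]
        rintro _ ⟨⟨_, h, hh, rfl⟩, -, D, -, rfl⟩
        refine ⟨-D h, by simp, ?_⟩
        change LieDerivation.ad K L (-D h) = ⁅LieDerivation.ad K L h, D⁆
        rw [← lie_skew, LieDerivation.lie_der_ad_eq_ad_der, map_neg]
      | succ j ih =>
        rw [LieModule.lowerCentralSeries_succ, LieSubmodule.lieIdeal_oper_eq_linear_span', Submodule.span_le]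
        rintro _ ⟨⟨_, h, hh, rfl⟩, -, D, hD, rfl⟩
        obtain ⟨x, hx, rfl⟩ := ih hD
        refine ⟨⁅h, x⁆, ?_, LieHom.map_lie _ _ _⟩
        rw [LieModule.lowerCentralSeries_succ]
        exact LieSubmodule.lie_mem_lie (LieSubmodule.mem_top (⟨h, hh⟩ : H)) hx
    exact (key k).trans (Submodule.map_mono hk)

/-- Bracketing with the lower central series of a subalgebra. -/
theorem LieSubalgebra.lie_mem_lowerCentralSeries_add (H : LieSubalgebra K L) (i j : ℕ) {a : H}
    (ha : a ∈ lowerCentralSeries K H H j) {l : L} (hl : l ∈ lowerCentralSeries K H L i) :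
    ⁅(a : L), l⁆ ∈ lowerCentralSeries K H L (i + j + 1) := by
  induction j generalizing i a l with
  | zero =>
    rw [add_zero, LieModule.lowerCentralSeries_succ]
    exact LieSubmodule.lie_mem_lie (LieSubmodule.mem_top a) hl
  | succ j ih =>
    rw [LieModule.lowerCentralSeries_succ, ← LieSubmodule.mem_toSubmodule,
      LieSubmodule.lieIdeal_oper_eq_linear_span'] at ha
    have hstep (n : ℕ) (b : H) {m : L} (hm : m ∈ lowerCentralSeries K H L n) :
        ⁅(b : L), m⁆ ∈ lowerCentralSeries K H L (n + 1) := by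
      rw [LieModule.lowerCentralSeries_succ]
      exact LieSubmodule.lie_mem_lie (LieSubmodule.mem_top b) hm
    induction ha using Submodule.span_induction with
    | mem y hy =>
      obtain ⟨b, -, c, hc, rfl⟩ := hy
      rw [LieSubalgebra.coe_bracket, lie_lie]
      refine sub_mem ?_ ?_
      · exact hstep _ b (ih i hc hl)
      · have := ih (i + 1) hc (hstep i b hl)
        rwa [show i + 1 + j + 1 = i + (j + 1) + 1 by omega] at this
    | zero => simp
    | add a b _ _ ha hb =>
      change ⁅(a : L) + b, l⁆ ∈ _
      rw [add_lie]
      exact add_mem ha hb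
    | smul c a _ ha =>
      change ⁅c • (a : L), l⁆ ∈ _
      rw [smul_lie]
      exact SMulMemClass.smul_mem c ha

/-- The dimension of a Lie algebra is bounded in terms of that of a subnormal subalgebra with
trivial centralizer. -/
theorem LieSubalgebra.IsSubnormalCentralizing.finrank_le [FiniteDimensional K L]
    {H : LieSubalgebra K L} (hH : H.IsSubnormalCentralizing) :
    finrank K L ≤ finrank K H ^ 2 + finrank K H := by
  obtain ⟨k, hk⟩ := hH.exists_lcs_le
  let X (j : ℕ) : Submodule K L :=
    (lowerCentralSeries K H H j).toSubmodule.map (H.subtype : H →ₗ[K] L)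
  have hlcsX (j : ℕ) : (lowerCentralSeries K H L (k + j)).toSubmodule ≤ X j := by
    induction j with
    | zero =>
      refine hk.trans fun x hx => ⟨⟨x, hx⟩, by simp, rfl⟩
    | succ j ih =>
      rw [← add_assoc, LieModule.lowerCentralSeries_succ, LieSubmodule.lieIdeal_oper_eq_linear_span',
        Submodule.span_le]
      rintro _ ⟨h, -, x, hx, rfl⟩
      obtain ⟨y, hy, rfl⟩ := ih hx
      refine ⟨⁅h, y⁆, ?_, rfl⟩
      rw [LieModule.lowerCentralSeries_succ]
      exact LieSubmodule.lie_mem_lie (LieSubmodule.mem_top h) hy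
  obtain ⟨m, hm⟩ := Filter.eventually_atTop.mp
    (LieModule.eventually_iInf_lowerCentralSeries_eq K H H)
  have hXm (j : ℕ) (hj : m ≤ j) : X j = X m := by
    simp only [X]
    rw [← hm j hj, ← hm m le_rfl]
  have hlcs : (lowerCentralSeries K H L (k + m)).toSubmodule ≤ X m := hlcsX m
  -- The nilpotent residual `X m` of `H` is an ideal of the whole of `L`: it equals `X (k + m)`,
  -- whose elements push `L` deep enough into the lower central series to land in `X m`.
  have hstable (l x : L) (hx : x ∈ X m) : ⁅l, x⁆ ∈ X m := by
    rw [← hXm (k + m) (by omega)] at hx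
    obtain ⟨a, ha, rfl⟩ := hx
    have h1 : ⁅(a : L), l⁆ ∈ lowerCentralSeries K H L (0 + (k + m) + 1) :=
      H.lie_mem_lowerCentralSeries_add 0 (k + m) ha (by simp)
    have h2 : ⁅(a : L), l⁆ ∈ X m :=
      hlcs (antitone_lowerCentralSeries K H L (by omega) h1)
    rw [← lie_skew]
    exact neg_mem h2
  let C : LieSubmodule K H L :=
    { carrier := {l | ∀ x ∈ X m, ⁅x, l⁆ = 0}
      add_mem' := fun {a b} ha hb x hx => by rw [lie_add, ha x hx, hb x hx, add_zero]
      zero_mem' := fun x _ => lie_zero x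
      smul_mem' := fun c l hl x hx => by rw [lie_smul, hl x hx, smul_zero]
      lie_mem := fun {h l} hl x hx => by
        change ⁅x, ⁅(h : L), l⁆⁆ = 0
        have h1 : ⁅⁅x, (h : L)⁆, l⁆ = 0 := by
          rw [← lie_skew x, neg_lie, hl _ (hstable h x hx), neg_zero]
        rw [leibniz_lie, h1, hl x hx, lie_zero, add_zero] }
  -- On the centralizer `C` of `X m`, `H` acts through a nilpotent quotient and without invariants,
  -- so `⁅H, C⁆ = C`. Iterating puts `C` inside `X m`. Since `L` modulo the centralizer of `X m`
  -- embeds in `End (X m)`, the bound follows.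
  have hC1 : lowerCentralSeries K H C 1 = ⊤ := by
    refine (maxTrivSubmodule_eq_bot_iff (k := m) ?_).mp ?_
    · rintro a ha ⟨l, hl⟩
      exact Subtype.ext (hl a ⟨a, ha, rfl⟩)
    · rw [LieSubmodule.eq_bot_iff]
      rintro ⟨l, hl⟩ hl'
      rw [mem_maxTrivSubmodule] at hl'
      exact Subtype.ext (hH.eq_zero_of_forall_lie l
        fun h hh => congrArg Subtype.val (hl' ⟨h, hh⟩))
  have hCj (j : ℕ) : lowerCentralSeries K H C j = ⊤ := by
    induction j with
    | zero => simp
    | succ j ih =>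
      rw [LieModule.lowerCentralSeries_succ, ih]
      simpa using hC1
  have hCX : C.toSubmodule ≤ X m := by
    refine le_trans (fun l hl => ?_) hlcs
    have h1 : (⟨l, hl⟩ : C) ∈ lowerCentralSeries K H C (k + m) := by rw [hCj]; trivial
    exact map_lowerCentralSeries_le (k := k + m) C.incl ⟨_, h1, rfl⟩
  let ρ : L →ₗ[K] Module.End K (X m) :=
    LinearMap.mk₂ K (fun l x => (⟨⁅l, x⁆, hstable l x x.2⟩ : X m))
      (fun a b x => Subtype.ext (add_lie _ _ _)) (fun c a x => Subtype.ext (smul_lie _ _ _))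
      (fun a x y => Subtype.ext (lie_add _ _ _)) (fun c a x => Subtype.ext (lie_smul _ _ _))
  have hker : LinearMap.ker ρ ≤ C.toSubmodule := by
    intro l hl x hx
    have h1 : ⁅l, x⁆ = 0 := congrArg Subtype.val (LinearMap.congr_fun hl ⟨x, hx⟩)
    rw [← lie_skew, h1, neg_zero]
  have hX : finrank K (X m) ≤ finrank K H :=
    (Submodule.finrank_map_le _ _).trans (Submodule.finrank_le _)
  have h1 := ρ.finrank_range_add_finrank_ker
  have h2 : finrank K (LinearMap.ker ρ) ≤ finrank K (X m) :=
    Submodule.finrank_mono (hker.trans hCX)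
  have h3 : finrank K (LinearMap.range ρ) ≤ finrank K (X m) * finrank K (X m) := by
    rw [← Module.finrank_linearMap K K]
    exact Submodule.finrank_le _
  nlinarith

end

/-! ### Derivations vanishing on an ideal, and dimension counts. -/

section

variable {K : Type u} {L : Type v} [Field K] [LieRing L] [LieAlgebra K L]

/-- The centralizer of an ideal, as an ideal. -/
def LieIdeal.centralizerIdeal (J : LieIdeal K L) : LieIdeal K L where
  carrier := {u | ∀ j ∈ J, ⁅u, j⁆ = 0}
  add_mem' ha hb j hj := by rw [add_lie, ha j hj, hb j hj, add_zero]
  zero_mem' j _ := zero_lie j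
  smul_mem' c u hu j hj := by rw [smul_lie, hu j hj, smul_zero]
  lie_mem {a u} hu j hj := by
    rw [lie_lie, hu j hj, hu _ (lie_mem_right K L J a j hj), lie_zero, sub_zero]

theorem LieIdeal.center_le_centralizerIdeal (J : LieIdeal K L) :
    center K L ≤ J.centralizerIdeal := by
  intro z hz j _
  rw [← lie_skew, (mem_maxTrivSubmodule K L L z).mp hz j, neg_zero]

/-- The derivations vanishing on an ideal. -/
def LieIdeal.vanishingDerivations (J : LieIdeal K L) : Submodule K (LieDerivation K L L) where
  carrier := {D | ∀ j ∈ J, D j = 0}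
  add_mem' ha hb j hj := by rw [LieDerivation.add_apply, ha j hj, hb j hj, add_zero]
  zero_mem' j _ := rfl
  smul_mem' c D hD j hj := by rw [LieDerivation.smul_apply, hD j hj, smul_zero]

theorem LieIdeal.apply_mem_centralizerIdeal {J : LieIdeal K L} {D : LieDerivation K L L}
    (hD : D ∈ J.vanishingDerivations) (u : L) : D u ∈ J.centralizerIdeal := by
  intro j hj
  have h := D.apply_lie_eq_add u j
  rw [hD _ (lie_mem_right K L J u j hj), hD j hj, lie_zero, zero_add] at h
  exact h.symm

/-- The kernel of a functional vanishing on brackets is an ideal. -/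
def LieAlgebra.kerIdeal (f : L →ₗ[K] K) (hf : ∀ a b : L, f ⁅a, b⁆ = 0) : LieIdeal K L where
  toSubmodule := LinearMap.ker f
  lie_mem _ := hf _ _

theorem LieAlgebra.mem_kerIdeal {f : L →ₗ[K] K} {hf : ∀ a b : L, f ⁅a, b⁆ = 0} {u : L} :
    u ∈ kerIdeal f hf ↔ f u = 0 := Iff.rfl

/-- The range of the adjoint representation, as a subspace of the space of derivations. -/
abbrev LieDerivation.rangeAd (K : Type u) (L : Type v) [Field K] [LieRing L] [LieAlgebra K L] :
    Submodule K (LieDerivation K L L) :=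
  LinearMap.range (LieDerivation.ad K L : L →ₗ[K] LieDerivation K L L)

theorem LieDerivation.ker_ad_toLinearMap :
    LinearMap.ker (LieDerivation.ad K L : L →ₗ[K] LieDerivation K L L) =
      (center K L).toSubmodule := by
  rw [← LieDerivation.ad_ker_eq_center]
  rfl

variable [FiniteDimensional K L]

instance LieDerivation.finiteDimensional : FiniteDimensional K (LieDerivation K L L) :=
  Module.IsNoetherian.finite K _

/-- The space spanned by inner derivations and derivations vanishing on an ideal. -/
theorem LieIdeal.finrank_rangeAd_sup_vanishingDerivations (J : LieIdeal K L) :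
    finrank K ↥(LieDerivation.rangeAd K L ⊔ J.vanishingDerivations) + finrank K J.centralizerIdeal =
      finrank K L + finrank K J.vanishingDerivations := by
  let f : L →ₗ[K] LieDerivation K L L := LieDerivation.ad K L
  -- `ad u` vanishes on `J` exactly when `u` centralizes `J`. The centralizer contains the center,
  -- so the dimension of the center cancels in the final count.
  have hinf : LieDerivation.rangeAd K L ⊓ J.vanishingDerivations =
      J.centralizerIdeal.toSubmodule.map f := by
    ext D
    constructor
    · rintro ⟨⟨u, rfl⟩, hD⟩
      refine ⟨u, fun j hj => ?_, rfl⟩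
      simpa using hD j hj
    · rintro ⟨u, hu, rfl⟩
      refine ⟨⟨u, rfl⟩, fun j hj => ?_⟩
      simpa [f] using hu j hj
  have h1 := Submodule.finrank_sup_add_finrank_inf_eq (LieDerivation.rangeAd K L)
    J.vanishingDerivations
  have h2 := f.finrank_range_add_finrank_ker
  have h3 := (f.domRestrict J.centralizerIdeal.toSubmodule).finrank_range_add_finrank_ker
  have h4 : finrank K (LinearMap.ker (f.domRestrict J.centralizerIdeal.toSubmodule)) =
      finrank K (LinearMap.ker f) := by
    have hle : LinearMap.ker f ≤ J.centralizerIdeal.toSubmodule := by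
      rw [LieDerivation.ker_ad_toLinearMap]
      exact J.center_le_centralizerIdeal
    exact LinearEquiv.finrank_eq (Submodule.comapSubtypeEquivOfLe hle)
  rw [LinearMap.range_domRestrict, ← hinf, h4] at h3
  have h5 : finrank K J.centralizerIdeal.toSubmodule = finrank K J.centralizerIdeal := rfl
  have h6 : finrank K (LinearMap.range f) = finrank K (LieDerivation.rangeAd K L) := rfl
  omega

theorem LieIdeal.finrank_add_le (J : LieIdeal K L) :
    finrank K L + finrank K J.vanishingDerivations ≤
      finrank K (LieDerivation K L L) + finrank K J.centralizerIdeal := by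
  rw [← J.finrank_rangeAd_sup_vanishingDerivations]
  exact Nat.add_le_add_right (Submodule.finrank_le _) _

end

section

variable {K : Type u} {L : Type v} [Field K] [LieRing L] [LieAlgebra K L]

theorem LieAlgebra.sub_smul_mem_kerIdeal {f : L →ₗ[K] K} {hf : ∀ a b : L, f ⁅a, b⁆ = 0} {x : L}
    (hx : f x = 1) (u : L) : u - f u • x ∈ kerIdeal f hf := by
  simp [mem_kerIdeal, hx]

theorem LieAlgebra.lie_eq_smul_of_mem_centralizerIdeal {f : L →ₗ[K] K}
    {hf : ∀ a b : L, f ⁅a, b⁆ = 0} {x : L} (hx : f x = 1) {c : L}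
    (hc : c ∈ (kerIdeal f hf).centralizerIdeal) (u : L) : ⁅c, u⁆ = f u • ⁅c, x⁆ := by
  have h : ⁅c, u - f u • x⁆ = 0 := hc _ (sub_smul_mem_kerIdeal hx u)
  rwa [lie_sub, lie_smul, sub_eq_zero] at h

theorem LieAlgebra.apply_eq_smul_of_mem_vanishingDerivations {f : L →ₗ[K] K}
    {hf : ∀ a b : L, f ⁅a, b⁆ = 0} {x : L} (hx : f x = 1) {D : LieDerivation K L L}
    (hD : D ∈ (kerIdeal f hf).vanishingDerivations) (u : L) : D u = f u • D x := by
  have h : D (u - f u • x) = 0 := hD _ (sub_smul_mem_kerIdeal hx u)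
  rwa [map_sub, map_smul, sub_eq_zero] at h

/-- The derivation `u ↦ f u • c`, for a functional `f` vanishing on brackets. -/
def LieDerivation.ofFunctional (f : L →ₗ[K] K) (hf : ∀ a b : L, f ⁅a, b⁆ = 0) (c : L)
    (hc : ∀ a b : L, f a • ⁅c, b⁆ = f b • ⁅c, a⁆) : LieDerivation K L L where
  toLinearMap := f.smulRight c
  leibniz' a b := by
    rw [LinearMap.smulRight_apply, LinearMap.smulRight_apply, LinearMap.smulRight_apply, hf,
      zero_smul, lie_smul, lie_smul, ← lie_skew, ← lie_skew b, smul_neg, smul_neg, hc a b,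
      sub_self]

@[simp]
theorem LieDerivation.ofFunctional_apply (f : L →ₗ[K] K) (hf : ∀ a b : L, f ⁅a, b⁆ = 0) (c : L)
    (hc : ∀ a b : L, f a • ⁅c, b⁆ = f b • ⁅c, a⁆) (u : L) :
    LieDerivation.ofFunctional f hf c hc u = f u • c := rfl

theorem LieAlgebra.smul_lie_comm_of_mem_centralizerIdeal {f : L →ₗ[K] K}
    {hf : ∀ a b : L, f ⁅a, b⁆ = 0} {x : L} (hx : f x = 1) {c : L}
    (hc : c ∈ (kerIdeal f hf).centralizerIdeal) (a b : L) : f a • ⁅c, b⁆ = f b • ⁅c, a⁆ := by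
  rw [lie_eq_smul_of_mem_centralizerIdeal hx hc b, lie_eq_smul_of_mem_centralizerIdeal hx hc a,
    smul_smul, smul_smul, mul_comm]

/-- If `L` is perfect, then its derivation algebra has trivial center. -/
theorem LieAlgebra.center_lieDerivation_eq_bot_of_perfect (h : derivedSeries K L 1 = ⊤) :
    center K (LieDerivation K L L) = ⊥ := by
  rw [LieSubmodule.eq_bot_iff]
  intro D hD
  rw [mem_maxTrivSubmodule] at hD
  have hDc (u v : L) : ⁅D u, v⁆ = 0 := by
    have h1 := LieDerivation.lie_der_ad_eq_ad_der D u
    rw [← lie_skew, hD, neg_zero] at h1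
    simpa using LieDerivation.congr_fun h1.symm v
  ext u
  have hu : u ∈ (derivedSeries K L 1).toSubmodule := by rw [h]; trivial
  rw [derivedSeries_def, derivedSeriesOfIdeal_succ,
    LieSubmodule.lieIdeal_oper_eq_linear_span'] at hu
  induction hu using Submodule.span_induction with
  | mem y hy =>
    obtain ⟨a, -, b, -, rfl⟩ := hy
    rw [D.apply_lie_eq_add, hDc, ← lie_skew, hDc, neg_zero, add_zero]
    rfl
  | zero => simp
  | add a b _ _ ha hb => rw [map_add, ha, hb]; simp
  | smul c a _ ha => rw [map_smul, ha]; simp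

variable [FiniteDimensional K L]

/-- The map sending `c` to the derivation `u ↦ f u • c` is injective, as evaluation at `x` recovers
`c`. -/
theorem LieAlgebra.finrank_centralizerIdeal_kerIdeal_le {f : L →ₗ[K] K}
    (hf : ∀ a b : L, f ⁅a, b⁆ = 0) {x : L} (hx : f x = 1) :
    finrank K (kerIdeal f hf).centralizerIdeal ≤
      finrank K (kerIdeal f hf).vanishingDerivations := by
  let φ : (kerIdeal f hf).centralizerIdeal →ₗ[K] (kerIdeal f hf).vanishingDerivations :=
    { toFun := fun c => ⟨LieDerivation.ofFunctional f hf c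
        (smul_lie_comm_of_mem_centralizerIdeal hx c.2), fun j hj => by
          rw [LieDerivation.ofFunctional_apply, mem_kerIdeal.mp hj, zero_smul]⟩
      map_add' := fun a b => Subtype.ext (LieDerivation.ext fun u => smul_add _ _ _)
      map_smul' := fun r a => Subtype.ext (LieDerivation.ext fun u => smul_comm _ _ _) }
  refine LinearMap.finrank_le_finrank_of_injective (f := φ) fun a b hab => ?_
  have h := LieDerivation.congr_fun (congrArg Subtype.val hab) x
  simpa [φ, hx] using h

/-- A functional vanishing on brackets and nonzero at a point outside the derived ideal. -/
theorem LieAlgebra.exists_functional_of_notMem {x : L} (h : x ∉ derivedSeries K L 1) :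
    ∃ f : L →ₗ[K] K, (∀ a b : L, f ⁅a, b⁆ = 0) ∧ f x = 1 := by
  obtain ⟨f, hfx, hf⟩ := Submodule.exists_dual_map_eq_bot_of_notMem
    (p := (derivedSeries K L 1).toSubmodule) (x := x) h inferInstance
  refine ⟨(f x)⁻¹ • f, fun a b => ?_, by simp [hfx]⟩
  have : ⁅a, b⁆ ∈ derivedSeries K L 1 := by
    rw [derivedSeries_def, derivedSeriesOfIdeal_succ]
    exact LieSubmodule.lie_mem_lie (LieSubmodule.mem_top a) (LieSubmodule.mem_top b)
  have h0 : f ⁅a, b⁆ ∈ (derivedSeries K L 1).toSubmodule.map f := ⟨_, this, rfl⟩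
  rw [hf, Submodule.mem_bot] at h0
  simp [h0]

/-- A Lie algebra which is not perfect has at least as many derivations as elements. -/
theorem LieAlgebra.finrank_le_finrank_lieDerivation (h : derivedSeries K L 1 ≠ ⊤) :
    finrank K L ≤ finrank K (LieDerivation K L L) := by
  obtain ⟨x, -, hx⟩ := SetLike.exists_of_lt h.lt_top
  obtain ⟨f, hf, hfx⟩ := exists_functional_of_notMem hx
  have h1 := (kerIdeal f hf).finrank_add_le
  have h2 := finrank_centralizerIdeal_kerIdeal_le hf hfx
  omega

/-- If a Lie algebra with nonzero center has abelianization of dimension at least two, then its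
dimension is less than that of its derivation algebra. -/
theorem LieAlgebra.finrank_lt_finrank_lieDerivation (hZ : center K L ≠ ⊥)
    {f g : L →ₗ[K] K} (hf : ∀ a b : L, f ⁅a, b⁆ = 0) (hg : ∀ a b : L, g ⁅a, b⁆ = 0) {x y : L}
    (hfx : f x = 1) (hfy : f y = 0) (hgx : g x = 0) (hgy : g y = 1) :
    finrank K L < finrank K (LieDerivation K L L) := by
  let J : LieIdeal K L := kerIdeal f hf ⊓ kerIdeal g hg
  have hJ (u : L) : u ∈ J ↔ f u = 0 ∧ g u = 0 := Iff.rfl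
  let C := J.centralizerIdeal
  have hC {c : L} (hc : c ∈ C) (u : L) : ⁅c, u⁆ = f u • ⁅c, x⁆ + g u • ⁅c, y⁆ := by
    have h : ⁅c, u - (f u • x + g u • y)⁆ = 0 := by
      refine hc _ ((hJ _).mpr ?_)
      simp [hfx, hfy, hgx, hgy]
    rwa [lie_sub, lie_add, lie_smul, lie_smul, sub_eq_zero] at h
  -- The center is a nonzero space of invariants in `C`, and `⁅L, L⁆ ⊆ J` acts trivially on `C`;
  -- hence `C` has nonzero coinvariants.
  have hcoinv : lowerCentralSeries K L C 1 ≠ ⊤ := by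
    rw [Ne, ← maxTrivSubmodule_eq_bot_iff (k := 1)]
    · rw [Ne, LieSubmodule.eq_bot_iff] at hZ
      rw [LieSubmodule.eq_bot_iff]
      refine fun h => hZ fun z hz => ?_
      refine congrArg Subtype.val (h ⟨z, J.center_le_centralizerIdeal hz⟩ ?_)
      rw [mem_maxTrivSubmodule] at hz ⊢
      exact fun u => Subtype.ext (hz u)
    · rintro a ha ⟨c, hc⟩
      have haJ : a ∈ J := by
        have hle : lowerCentralSeries K L L 1 ≤ J := by
          rw [LieModule.lowerCentralSeries_succ, LieSubmodule.lie_le_iff]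
          exact fun u _ v _ => (hJ _).mpr ⟨hf u v, hg u v⟩
        exact hle ha
      refine Subtype.ext ?_
      change ⁅a, c⁆ = 0
      rw [← lie_skew, hc a haJ, neg_zero]
  -- For `u ↦ f u • c₁ + g u • c₂` the Leibniz rule reduces to `⁅x, c₂⁆ = ⁅y, c₁⁆`, that is, to the
  -- kernel of `Φ`. The range lies in `⁅L, C⁆ ≠ C`, so this kernel has dimension greater than `dim
  -- C`.
  let Φ : C × C →ₗ[K] C :=
    { toFun := fun c => ⁅x, c.2⁆ - ⁅y, c.1⁆
      map_add' := fun a b => by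
        rw [Prod.snd_add, Prod.fst_add, lie_add, lie_add, add_sub_add_comm]
      map_smul' := fun r a => by
        rw [Prod.smul_snd, Prod.smul_fst, lie_smul, lie_smul, ← smul_sub, RingHom.id_apply] }
  have hrange : LinearMap.range Φ ≠ ⊤ := by
    intro h
    refine hcoinv (eq_top_iff.mpr fun c _ => ?_)
    obtain ⟨⟨c₁, c₂⟩, rfl⟩ : c ∈ LinearMap.range Φ := h ▸ trivial
    rw [LieModule.lowerCentralSeries_succ]
    exact sub_mem (LieSubmodule.lie_mem_lie (LieSubmodule.mem_top x) (LieSubmodule.mem_top c₂))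
      (LieSubmodule.lie_mem_lie (LieSubmodule.mem_top y) (LieSubmodule.mem_top c₁))
  let D (c : LinearMap.ker Φ) : LieDerivation K L L :=
    { toLinearMap := f.smulRight (c.1.1 : L) + g.smulRight (c.1.2 : L)
      leibniz' := fun a b => by
        have h : ⁅x, (c.1.2 : L)⁆ - ⁅y, (c.1.1 : L)⁆ = 0 := congrArg Subtype.val c.2
        have h1 := hC c.1.1.2
        have h2 := hC c.1.2.2
        have h3 (u : L) : ⁅u, (c.1.1 : L)⁆ = f u • ⁅x, (c.1.1 : L)⁆ + g u • ⁅y, (c.1.1 : L)⁆ := by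
          rw [← lie_skew, h1 u, ← lie_skew x, ← lie_skew y, smul_neg, smul_neg, neg_add]
        have h4 (u : L) : ⁅u, (c.1.2 : L)⁆ = f u • ⁅x, (c.1.2 : L)⁆ + g u • ⁅y, (c.1.2 : L)⁆ := by
          rw [← lie_skew, h2 u, ← lie_skew x, ← lie_skew y, smul_neg, smul_neg, neg_add]
        rw [sub_eq_zero] at h
        simp only [LinearMap.add_apply, LinearMap.smulRight_apply, hf, hg, zero_smul, add_zero,
          lie_add, lie_smul]
        rw [h3 a, h3 b, h4 a, h4 b, h]
        module }
  let φ : LinearMap.ker Φ →ₗ[K] J.vanishingDerivations :=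
    { toFun := fun c => ⟨D c, fun j hj => by
          change f j • (c.1.1 : L) + g j • (c.1.2 : L) = 0
          rw [((hJ j).mp hj).1, ((hJ j).mp hj).2, zero_smul, zero_smul, add_zero]⟩
      map_add' := fun a b => Subtype.ext <| LieDerivation.ext fun u => by
        change f u • ((a.1.1 : L) + b.1.1) + g u • ((a.1.2 : L) + b.1.2) =
          (f u • (a.1.1 : L) + g u • (a.1.2 : L)) + (f u • (b.1.1 : L) + g u • (b.1.2 : L))
        module
      map_smul' := fun r a => Subtype.ext <| LieDerivation.ext fun u => by
        change f u • (r • (a.1.1 : L)) + g u • (r • (a.1.2 : L)) =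
          r • (f u • (a.1.1 : L) + g u • (a.1.2 : L))
        module }
  have hφ : Function.Injective φ := by
    intro a b hab
    have h (u : L) : f u • (a.1.1 : L) + g u • (a.1.2 : L) =
        f u • (b.1.1 : L) + g u • (b.1.2 : L) :=
      LieDerivation.congr_fun (congrArg Subtype.val hab) u
    have hx' := h x
    have hy' := h y
    rw [hfx, hgx, zero_smul, zero_smul, add_zero, add_zero, one_smul, one_smul] at hx'
    rw [hfy, hgy, zero_smul, zero_smul, zero_add, zero_add, one_smul, one_smul] at hy'
    exact Subtype.ext (Prod.ext (Subtype.ext hx') (Subtype.ext hy'))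
  have h1 := LinearMap.finrank_le_finrank_of_injective hφ
  have h2 := Φ.finrank_range_add_finrank_ker
  have h3 := Submodule.finrank_lt hrange
  have h4 := J.finrank_add_le
  rw [Module.finrank_prod] at h2
  have h5 : finrank K C = finrank K J.centralizerIdeal := rfl
  omega

end

/-! ### Jordan decomposition of derivations. -/

section

variable {K V W : Type*} [Field K] [AddCommGroup V] [Module K V] [FiniteDimensional K V]
  [AddCommGroup W] [Module K W] [FiniteDimensional K W]

/-- Two endomorphisms have their semisimple parts given by a common polynomial. -/
theorem Module.End.exists_aeval_isSemisimple_isNilpotent_pair [PerfectField K]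
    (f : Module.End K V) (g : Module.End K W) :
    ∃ p : Polynomial K, (Polynomial.aeval f p).IsSemisimple ∧ (Polynomial.aeval g p).IsSemisimple ∧
      IsNilpotent (f - Polynomial.aeval f p) ∧ IsNilpotent (g - Polynomial.aeval g p) := by
  -- A single polynomial comes from the Jordan–Chevalley decomposition of the block-diagonal
  -- endomorphism of `V × W`.
  let φ : Module.End K V × Module.End K W →ₐ[K] Module.End K (V × W) :=
    LinearMap.prodMapAlgHom K V W
  have hφ : Function.Injective φ := by
    rintro ⟨a, b⟩ ⟨c, d⟩ h
    refine Prod.ext (LinearMap.ext fun v => ?_) (LinearMap.ext fun w => ?_)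
    · exact congrArg Prod.fst (LinearMap.congr_fun h (v, 0))
    · exact congrArg Prod.snd (LinearMap.congr_fun h (0, w))
  obtain ⟨n, -, s, hs, hn, hss, h⟩ := (φ (f, g)).exists_isNilpotent_isSemisimple
  rw [Algebra.adjoin_singleton_eq_range_aeval] at hs
  obtain ⟨p, hp⟩ := hs
  have hpair : Polynomial.aeval (f, g) p = (Polynomial.aeval f p, Polynomial.aeval g p) :=
    Prod.ext (Polynomial.aeval_algHom_apply (AlgHom.fst K _ _) (f, g) p).symm
      (Polynomial.aeval_algHom_apply (AlgHom.snd K _ _) (f, g) p).symm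
  have hs' : s = φ (Polynomial.aeval f p, Polynomial.aeval g p) := by
    rw [← hpair, ← Polynomial.aeval_algHom_apply]
    exact hp.symm
  have hn' : n = φ (f - Polynomial.aeval f p, g - Polynomial.aeval g p) := by
    rw [← Prod.mk_sub_mk, map_sub, ← hs', h, add_sub_cancel_right]
  have hann : Polynomial.aeval (Polynomial.aeval f p, Polynomial.aeval g p) (minpoly K s) = 0 := by
    apply hφ
    rw [← Polynomial.aeval_algHom_apply, ← hs', minpoly.aeval, map_zero]
  refine ⟨p, ?_, ?_, ?_, ?_⟩
  · refine isSemisimple_of_squarefree_aeval_eq_zero hss.minpoly_squarefree ?_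
    have := Polynomial.aeval_algHom_apply (AlgHom.fst K (Module.End K V) (Module.End K W))
      (Polynomial.aeval f p, Polynomial.aeval g p) (minpoly K s)
    rw [hann, map_zero] at this
    exact this
  · refine isSemisimple_of_squarefree_aeval_eq_zero hss.minpoly_squarefree ?_
    have := Polynomial.aeval_algHom_apply (AlgHom.snd K (Module.End K V) (Module.End K W))
      (Polynomial.aeval f p, Polynomial.aeval g p) (minpoly K s)
    rw [hann, map_zero] at this
    exact this
  · rw [hn', IsNilpotent.map_iff hφ] at hn
    exact hn.map (RingHom.fst _ _)
  · rw [hn', IsNilpotent.map_iff hφ] at hn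
    exact hn.map (RingHom.snd _ _)

omit [FiniteDimensional K V] in
theorem Module.End.IsSemisimple.apply_eq_zero_of_apply_apply_eq_zero {s : Module.End K V}
    (hs : s.IsSemisimple) {v : V} (h : s (s v) = 0) : s v = 0 := by
  have h1 := hs.isFinitelySemisimple.genEigenspace_eq_eigenspace 0 (k := 2) (by norm_num)
  have h2 : v ∈ s.genEigenspace 0 2 := by
    rw [show (2 : ℕ∞) = ((2 : ℕ) : ℕ∞) from rfl, Module.End.mem_genEigenspace_nat]
    simpa [pow_two] using h
  rw [h1, Module.End.mem_eigenspace_iff, zero_smul] at h2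
  exact h2

/-- A semisimple endomorphism splits an invariant subspace as kernel plus image. -/
theorem Module.End.IsSemisimple.exists_apply_sub_eq_zero {s : Module.End K V}
    (hs : s.IsSemisimple) {C : Submodule K V} (hC : ∀ c ∈ C, s c ∈ C) {m : V} (hm : m ∈ C) :
    ∃ c ∈ C, s (m - s c) = 0 := by
  let t : C →ₗ[K] C := s.restrict hC
  have hdisj : Disjoint (LinearMap.ker t) (LinearMap.range t) := by
    rw [Submodule.disjoint_def]
    rintro _ h1 ⟨c, rfl⟩
    have h2 : s (s c) = 0 := congrArg Subtype.val h1
    exact Subtype.ext (hs.apply_eq_zero_of_apply_apply_eq_zero h2)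
  have htop := Submodule.eq_top_of_disjoint _ _
    (by rw [add_comm]; exact t.finrank_range_add_finrank_ker.ge) hdisj
  obtain ⟨a, ha, _, ⟨c, rfl⟩, h⟩ := Submodule.mem_sup.mp (htop ▸ Submodule.mem_top : (⟨m, hm⟩ : C) ∈ _)
  refine ⟨c, c.2, ?_⟩
  have h1 : m - s c = a := by
    have : (a : V) + s c = m := congrArg Subtype.val h
    rw [← this, add_sub_cancel_right]
  rw [h1]
  exact congrArg Subtype.val ha

end

section

variable {K : Type u} {L : Type v} [Field K] [PerfectField K] [LieRing L] [LieAlgebra K L]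
  [FiniteDimensional K L]

attribute [local instance] LieRing.ofAssociativeRing in
/-- The semisimple part of a derivation with nonzero kernel is a derivation, which factors on both
sides through the given derivation. -/
theorem LieDerivation.exists_isSemisimple (D : LieDerivation K L L) {v : L} (hv : v ≠ 0)
    (hDv : D v = 0) :
    ∃ (S : LieDerivation K L L) (Q : Module.End K L),
      Module.End.IsSemisimple (S : Module.End K L) ∧
      IsNilpotent ((D : Module.End K L) - (S : Module.End K L)) ∧
      (∀ u, S u = D (Q u)) ∧ (∀ u, S u = Q (D u)) ∧
      ∀ C : Submodule K L, (∀ u ∈ C, D u ∈ C) → ∀ u ∈ C, Q u ∈ C := by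
  set d : Module.End K L := (D : Module.End K L) with hd
  obtain ⟨p, hs, hs', hn, hn'⟩ := Module.End.exists_aeval_isSemisimple_isNilpotent_pair d
    (LieAlgebra.ad K (Module.End K L) d)
  set s := Polynomial.aeval d p with hsdef
  have hcX {V : Type v} [AddCommGroup V] [Module K V] (e : Module.End K V) :
      Commute e (Polynomial.aeval e p) := by
    simpa using (Commute.all Polynomial.X p).map (Polynomial.aeval e)
  have hcomm : Commute (d - s) s :=
    (hcX d).sub_left (Commute.refl s)
  -- By uniqueness, `p (ad d)` is `ad s`. As `p (ad d)` sends `ad u` to `ad (p(d) u)`, this gives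
  -- `⁅s, ad u⁆ = ad (s u)`: `s` is a derivation.
  have huniq := Module.End.isNilpotent_isSemisimple_unique hn' hs'
    (LieAlgebra.ad_nilpotent_of_nilpotent (R := K) hn)
    (LieAlgebra.ad_isSemisimple_of_isSemisimple hs)
    ((hcX _).sub_left (Commute.refl _))
    (LieAlgebra.commute_ad_of_commute hcomm)
    (by rw [sub_add_cancel, ← map_add, sub_add_cancel])
  have hinter (q : Polynomial K) (u : L) :
      (Polynomial.aeval (LieAlgebra.ad K (Module.End K L) d) q) (LieAlgebra.ad K L u) =
        LieAlgebra.ad K L (Polynomial.aeval d q u) := by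
    induction q using Polynomial.induction_on' with
    | add a b ha hb => simp only [map_add, LinearMap.add_apply, ha, hb]
    | monomial n a =>
      simp only [Polynomial.aeval_monomial, Module.End.mul_apply, Module.algebraMap_end_apply]
      rw [map_smul]
      congr 1
      induction n with
      | zero => simp
      | succ n ih =>
        rw [pow_succ', pow_succ', Module.End.mul_apply, Module.End.mul_apply, ih]
        ext w
        simp [hd]
  have hder (a b : L) : s ⁅a, b⁆ = ⁅a, s b⁆ - ⁅b, s a⁆ := by
    have h1 := hinter p a
    rw [huniq.2] at h1
    have h2 := LinearMap.congr_fun h1 b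
    have h3 : s ⁅a, b⁆ - ⁅a, s b⁆ = ⁅s a, b⁆ := h2
    rw [← lie_skew b, sub_neg_eq_add, ← h3]
    abel
  -- On `v` the nilpotent part acts as the scalar `-p(0)`, which must vanish. Then `p = q X`, and `Q
  -- = q(d)`.
  have h0 : p.coeff 0 = 0 := by
    have key (q : Polynomial K) : Polynomial.aeval d q v = q.coeff 0 • v := by
      have h1 := q.divX_mul_X_add
      have h2 : Polynomial.aeval d (q.divX * Polynomial.X + Polynomial.C (q.coeff 0)) v =
          q.coeff 0 • v := by
        simp [hd, hDv]
      rwa [h1] at h2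
    have hdv : d v = 0 := hDv
    have hsv : s v = p.coeff 0 • v := key p
    obtain ⟨k, hk⟩ := hn
    have hpow (j : ℕ) : ((d - s) ^ j) v = (-p.coeff 0) ^ j • v := by
      induction j with
      | zero => simp
      | succ j ih =>
        rw [pow_succ', Module.End.mul_apply, ih, map_smul, LinearMap.sub_apply, hdv, hsv, zero_sub,
          ← neg_smul, smul_smul, pow_succ]
    have h1 := hpow k
    rw [hk, LinearMap.zero_apply] at h1
    have h2 := (smul_eq_zero.mp h1.symm).resolve_right hv
    exact neg_eq_zero.mp (eq_zero_of_pow_eq_zero h2)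
  have hp : p = p.divX * Polynomial.X := by
    conv_lhs => rw [← p.divX_mul_X_add, h0, Polynomial.C_0, add_zero]
  refine ⟨⟨s, hder⟩, Polynomial.aeval d p.divX, hs, hn, ?_, ?_, ?_⟩
  · intro u
    change s u = d _
    rw [hsdef]
    conv_lhs => rw [hp, mul_comm]
    simp
  · intro u
    change s u = _
    rw [hsdef]
    conv_lhs => rw [hp]
    simp [hd]
  · intro C hC u hu
    exact Polynomial.aeval_apply_smul_mem_of_le_comap hu _ _ hC

end

/-! ### Centers of the first and second derivation algebras. -/

section

variable {K : Type u} {L : Type v} [Field K] [LieRing L] [LieAlgebra K L]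

/-- If the center of `L` has a complement containing all brackets, and if the center and the
brackets do not span `L`, then the derivation algebra of `L` has trivial center. -/
theorem LieAlgebra.center_lieDerivation_eq_bot_of_isCompl {A N : Submodule K L}
    (hA : IsCompl (center K L).toSubmodule A) (hlieA : ∀ a b : L, ⁅a, b⁆ ∈ A)
    (hlieN : ∀ a b : L, ⁅a, b⁆ ∈ N) (hN : (center K L).toSubmodule ≤ N) (hN' : N ≠ ⊤) :
    center K (LieDerivation K L L) = ⊥ := by
  rw [LieSubmodule.eq_bot_iff]
  intro E hE
  rw [mem_maxTrivSubmodule] at hE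
  have hcomm (D : LieDerivation K L L) (u : L) : D (E u) = E (D u) := by
    have h := LieDerivation.congr_fun (hE D) u
    rwa [LieDerivation.lie_apply, LieDerivation.zero_apply, sub_eq_zero] at h
  have hElie (w u : L) : ⁅E w, u⁆ = 0 := by
    have h := hcomm (LieDerivation.ad K L w) u
    have h2 := E.apply_lie_eq_add w u
    have h3 : ⁅w, E u⁆ = E ⁅w, u⁆ := by simpa using h
    rwa [h3, left_eq_add] at h2
  have hEc (u : L) : E u ∈ center K L := by
    rw [mem_maxTrivSubmodule]
    intro w
    rw [← lie_skew, hElie, neg_zero]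
  have hcen {c : L} (hc : c ∈ center K L) (w : L) : ⁅w, c⁆ = 0 :=
    (mem_maxTrivSubmodule K L L c).mp hc w
  -- The projection onto the center along `A` is a derivation. A central `E` has values in the
  -- center and commutes with `P`, so it kills `A`; commuting with `f ⊗ c` for central `c` makes it
  -- kill the center.
  let P : LieDerivation K L L :=
    { toLinearMap := Submodule.projection _ _ hA
      leibniz' := fun a b => by
        have h1 : Submodule.projection _ _ hA ⁅a, b⁆ = 0 := by
          simpa using hlieA a b
        rw [h1, hcen (Submodule.projection_apply_mem _ _), hcen (Submodule.projection_apply_mem _ _),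
          sub_zero] }
  have hPA (a : L) (ha : a ∈ A) : E a = 0 := by
    have h1 : P (E a) = E a := Submodule.projection_apply_of_mem_left hA (hEc a)
    have h2 : P a = 0 := by
      change Submodule.projection _ _ hA a = 0
      simpa using ha
    rw [← h1, hcomm, h2, map_zero]
  obtain ⟨y, -, hy⟩ := SetLike.exists_of_lt hN'.lt_top
  obtain ⟨f, hfy, hf⟩ := Submodule.exists_le_ker_of_notMem hy
  have hfl (a b : L) : f ⁅a, b⁆ = 0 := hf (hlieN a b)
  have hPB (c : L) (hc : c ∈ center K L) : E c = 0 := by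
    have hc' (w : L) : ⁅c, w⁆ = 0 := by rw [← lie_skew, hcen hc, neg_zero]
    have h := hcomm (LieDerivation.ofFunctional f hfl c
      fun a b => by rw [hc', hc', smul_zero, smul_zero]) y
    rw [LieDerivation.ofFunctional_apply, LieDerivation.ofFunctional_apply,
      LinearMap.mem_ker.mp (hf (hN (hEc y))), zero_smul, map_smul] at h
    exact (smul_eq_zero.mp h.symm).resolve_left hfy
  ext u
  obtain ⟨c, hc, a, ha, rfl⟩ := Submodule.mem_sup.mp
    (hA.sup_eq_top ▸ Submodule.mem_top : u ∈ (center K L).toSubmodule ⊔ A)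
  rw [map_add, hPA a ha, hPB c hc, add_zero]
  rfl

variable [CharZero K] [FiniteDimensional K L]

/-- The element `x` is outside `[L, L]`, which gives `f`; a second independent functional would make
`Der L` too large. Equality in the dimension count gives the spanning statement. The semisimple part
of `ad x` need not be inner a priori, but is inner up to a derivation killing `ker f`, and this
error can be removed. -/
theorem LieAlgebra.exists_isSemisimple_ad_of_finrank_lieDerivation_le {x : L}
    (hxR : x ∈ radical K L) (hx : ¬ IsNilpotent (ad K L x)) (hZ : center K L ≠ ⊥)
    (hdim : finrank K (LieDerivation K L L) ≤ finrank K L) :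
    ∃ (f : L →ₗ[K] K) (hf : ∀ a b : L, f ⁅a, b⁆ = 0) (y : L), f y = 1 ∧
      (ad K L y).IsSemisimple ∧ (∀ u, f u = 0 → u ∈ derivedSeries K L 1) ∧
      (∀ c ∈ (kerIdeal f hf).centralizerIdeal, f c = 0) ∧
      LieDerivation.rangeAd K L ⊔ (kerIdeal f hf).vanishingDerivations = ⊤ := by
  have hxD : x ∉ derivedSeries K L 1 :=
    fun h => hx (isNilpotent_ad_of_mem_radical_of_mem_derivedSeries hxR h)
  obtain ⟨f, hf, hfx⟩ := exists_functional_of_notMem hxD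
  have hker (u : L) (hu : f u = 0) : u ∈ derivedSeries K L 1 := by
    by_contra hu'
    obtain ⟨g, hg, hgu⟩ := exists_functional_of_notMem hu'
    refine hdim.not_gt (finrank_lt_finrank_lieDerivation hZ hf (g := g - g x • f) (x := x) (y := u)
      (fun a b => ?_) hfx hu ?_ ?_)
    · simp [hf, hg]
    · simp [hfx]
    · simp [hu, hgu]
  have hnil {u : L} (hu : u ∈ radical K L) (hfu : f u = 0) : IsNilpotent (ad K L u) :=
    isNilpotent_ad_of_mem_radical_of_mem_derivedSeries hu (hker u hfu)
  -- Otherwise subtracting a multiple of `z` from `x` would give an element of the radical and of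
  -- `ker f` with the same adjoint map as `x`.
  have hZf (z : L) (hz : z ∈ center K L) : f z = 0 := by
    by_contra h
    have hz0 : ad K L z = 0 := by
      ext w
      rw [ad_apply, ← lie_skew, (mem_maxTrivSubmodule K L L z).mp hz w, neg_zero]
      rfl
    have h1 : ad K L (x - (f z)⁻¹ • z) = ad K L x := by
      rw [map_sub, map_smul, hz0, smul_zero, sub_zero]
    refine hx (h1 ▸ hnil (sub_mem hxR (SMulMemClass.smul_mem _ (center_le_radical K L hz))) ?_)
    simp [hfx, h]
  set C := (kerIdeal f hf).centralizerIdeal with hCdef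
  have hClie {c : L} (hc : c ∈ C) (u : L) : ⁅c, u⁆ = f u • ⁅c, x⁆ :=
    lie_eq_smul_of_mem_centralizerIdeal hfx hc u
  have hCf (c : L) (hc : c ∈ C) : f c = 0 := by
    by_contra h
    have h1 : ⁅c, x⁆ = 0 := by
      have h2 := hClie hc c
      rw [lie_self] at h2
      exact (smul_eq_zero.mp h2.symm).resolve_left h
    refine h (hZf c ((mem_maxTrivSubmodule K L L c).mpr fun u => ?_))
    rw [← lie_skew, hClie hc, h1, smul_zero, neg_zero]
  have hCR {c : L} (hc : c ∈ C) : c ∈ radical K L := by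
    refine normalizer_radical_le ((LieSubmodule.mem_normalizer _ _).mpr fun u => ?_)
    rw [← lie_skew, hClie hc]
    exact neg_mem (SMulMemClass.smul_mem _ (lie_mem_right K L _ c x hxR))
  have hsup : LieDerivation.rangeAd K L ⊔ (kerIdeal f hf).vanishingDerivations = ⊤ := by
    refine Submodule.eq_top_of_finrank_eq (le_antisymm (Submodule.finrank_le _) ?_)
    have h1 := (kerIdeal f hf).finrank_rangeAd_sup_vanishingDerivations
    have h2 := finrank_centralizerIdeal_kerIdeal_le hf hfx
    omega
  have hx0 : x ≠ 0 := by
    rintro rfl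
    exact hx (by simp)
  obtain ⟨S, Q, hss, hDS, hS1, hS2, hQ⟩ :=
    (LieDerivation.ad K L x).exists_isSemisimple hx0 (by simp)
  replace hS1 (u : L) : S u = ⁅x, Q u⁆ := by simpa using hS1 u
  replace hS2 (u : L) : S u = Q ⁅x, u⁆ := by simpa using hS2 u
  have hQC (c : L) (hc : c ∈ C) : Q c ∈ C :=
    hQ C.toSubmodule (fun u hu => by simpa using lie_mem_right K L C x u hu) c hc
  have hSC (c : L) (hc : c ∈ C) : S c ∈ C := by
    rw [hS2]
    exact hQC _ (lie_mem_right K L C x c hc)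
  have hfS (u : L) : f (S u) = 0 := by rw [hS1, hf]
  have hSS (u : L) (hu : S (S u) = 0) : S u = 0 :=
    hss.apply_eq_zero_of_apply_apply_eq_zero hu
  obtain ⟨_, ⟨y₀, rfl⟩, φ, hφ, hSφ⟩ := Submodule.mem_sup.mp (hsup ▸ Submodule.mem_top : S ∈ _)
  have hm : φ x ∈ C := LieIdeal.apply_mem_centralizerIdeal hφ x
  obtain ⟨c, hc, hmc⟩ := hss.exists_apply_sub_eq_zero (C := C.toSubmodule) hSC hm
  -- As `Q c ∈ C`, `ad (Q c)` is `u ↦ -f u • S c`. Replacing `y₀` by `y₀ - Q c` therefore changes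
  -- the error vector from `φ x` to `m`, which `S` kills.
  set m := φ x - S c with hmdef
  have hmC : m ∈ C := sub_mem hm (hSC c hc)
  set y := y₀ - Q c with hydef
  have hSy (u : L) : S u = ⁅y, u⁆ + f u • m := by
    have h1 : S u = ⁅y₀, u⁆ + φ u := by
      have := LieDerivation.congr_fun hSφ.symm u
      simpa using this
    rw [h1, apply_eq_smul_of_mem_vanishingDerivations hfx hφ u, hydef, sub_lie, hmdef,
      hClie (hQC c hc) u, hS1, ← lie_skew x]
    module
  have hSm : S m = 0 := hmc
  have hSyc (u : L) : ⁅S y, u⁆ = 0 := by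
    have h1 := S.apply_lie_eq_add y u
    have h2 : ⁅y, u⁆ = S u - f u • m := by rw [hSy]; abel
    have h3 : ⁅y, S u⁆ = S (S u) := by rw [hSy (S u), hfS, zero_smul, add_zero]
    rw [h3, h2, map_sub, map_smul, hSm, smul_zero, sub_zero, left_eq_add] at h1
    exact h1
  have hSy0 : S y = 0 := by
    refine hSS y ?_
    rw [hS2, ← lie_skew, hSyc, neg_zero, map_zero]
  have hor : f y = 0 ∨ m = 0 := by
    have := hSy y
    rw [hSy0, lie_self, zero_add] at this
    exact smul_eq_zero.mp this.symm
  -- If `f y = 0`, then `y` is a radical element in `[L, L]`, hence ad-nilpotent. Since `S` and `ad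
  -- y` agree on the image of `S`, `S` is nilpotent as well as semisimple, so zero, and `ad x` is
  -- nilpotent.
  have hfy : f y ≠ 0 := by
    intro hfy
    have hyR : y ∈ radical K L := by
      refine normalizer_radical_le ((LieSubmodule.mem_normalizer _ _).mpr fun u => ?_)
      have h2 : ⁅y, u⁆ = S u - f u • m := by rw [hSy]; abel
      rw [← lie_skew, h2, hS1]
      exact neg_mem (sub_mem (lie_mem_left K L _ _ _ hxR) (SMulMemClass.smul_mem _ (hCR hmC)))
    obtain ⟨k, hk⟩ := hnil hyR hfy
    have hpow (j : ℕ) (u : L) : ((S : Module.End K L) ^ j) (S u) = (ad K L y ^ j) (S u) ∧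
        f ((ad K L y ^ j) (S u)) = 0 := by
      induction j with
      | zero => simp [hfS]
      | succ j ih =>
        rw [pow_succ', pow_succ', Module.End.mul_apply, Module.End.mul_apply, ih.1, ad_apply]
        refine ⟨?_, hf _ _⟩
        change S _ = _
        rw [hSy, ih.2, zero_smul, add_zero]
    have hSnil : IsNilpotent (S : Module.End K L) := by
      refine ⟨k + 1, ?_⟩
      ext u
      rw [pow_succ, Module.End.mul_apply]
      exact (hpow k u).1.trans (by rw [hk]; rfl)
    have hS0 := Module.End.eq_zero_of_isNilpotent_isSemisimple hSnil hss
    rw [hS0, sub_zero] at hDS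
    refine hx ?_
    convert hDS using 1
    ext u
    simp
  have hm0 : m = 0 := hor.resolve_left hfy
  refine ⟨f, hf, (f y)⁻¹ • y, by simp [hfy], ?_, hker, hCf, hsup⟩
  rw [map_smul]
  refine Module.End.IsSemisimple_smul _ ?_
  have : ad K L y = (S : Module.End K L) := by
    ext u
    change ⁅y, u⁆ = S u
    rw [hSy, hm0, smul_zero, add_zero]
  rw [this]
  exact hss

omit [CharZero K] in
-- Each derivation is `ad u + f ⊗ m` with `m ∈ C`. Semisimplicity of `ad y` splits `C` as `Z(L) ⊕
-- ⁅y, C⁆`; the second summand contributes inner derivations, and `f ⊗ z` with `z ∈ Z(L)` is central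
-- in `Der L`. So `Der L = Z(Der L) ⊕ ad L`, and all brackets lie in `ad (ker f)`, which with the
-- center does not reach `ad y`.
theorem LieAlgebra.center_lieDerivation_lieDerivation_eq_bot_of_isSemisimple {f : L →ₗ[K] K}
    (hf : ∀ a b : L, f ⁅a, b⁆ = 0) {y : L} (hfy : f y = 1) (hss : (ad K L y).IsSemisimple)
    (hker : ∀ u, f u = 0 → u ∈ derivedSeries K L 1)
    (hCf : ∀ c ∈ (kerIdeal f hf).centralizerIdeal, f c = 0)
    (hsup : LieDerivation.rangeAd K L ⊔ (kerIdeal f hf).vanishingDerivations = ⊤) :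
    center K (LieDerivation K (LieDerivation K L L) (LieDerivation K L L)) = ⊥ := by
  set C := (kerIdeal f hf).centralizerIdeal with hCdef
  have hClie {c : L} (hc : c ∈ C) (u : L) : ⁅c, u⁆ = f u • ⁅c, y⁆ :=
    lie_eq_smul_of_mem_centralizerIdeal hfy hc u
  have hdec (D : LieDerivation K L L) : ∃ u : L, ∃ m ∈ C, ∀ v, D v = ⁅u, v⁆ + f v • m := by
    obtain ⟨_, ⟨u, rfl⟩, φ, hφ, rfl⟩ := Submodule.mem_sup.mp (hsup ▸ Submodule.mem_top : D ∈ _)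
    refine ⟨u, φ y, LieIdeal.apply_mem_centralizerIdeal hφ y, fun v => ?_⟩
    rw [LieDerivation.add_apply, apply_eq_smul_of_mem_vanishingDerivations hfy hφ v]
    simp
  have hadapp (w v : L) : LieDerivation.ad K L w v = ⁅w, v⁆ := by simp
  have hfD (D : LieDerivation K L L) (v : L) : f (D v) = 0 := by
    obtain ⟨u, m, hm, h⟩ := hdec D
    rw [h, map_add, hf, map_smul, hCf m hm, smul_zero, add_zero]
  have hCZ {c : L} (hc : c ∈ C) (h : ⁅y, c⁆ = 0) : c ∈ center K L := by
    rw [mem_maxTrivSubmodule]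
    intro u
    rw [← lie_skew, hClie hc, ← lie_skew, h, neg_zero, smul_zero, neg_zero]
  have hZf (z : L) (hz : z ∈ center K L) : f z = 0 :=
    hCf z (LieIdeal.center_le_centralizerIdeal _ hz)
  have hlie (D₁ D₂ : LieDerivation K L L) :
      ⁅D₁, D₂⁆ ∈ (LinearMap.ker f).map (LieDerivation.ad K L : L →ₗ[K] LieDerivation K L L) := by
    obtain ⟨u₁, m₁, hm₁, h₁⟩ := hdec D₁
    obtain ⟨u₂, m₂, hm₂, h₂⟩ := hdec D₂
    refine ⟨⁅u₁, u₂⁆ + f u₂ • m₁ - f u₁ • m₂, ?_, ?_⟩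
    · simp [hf, hCf m₁ hm₁, hCf m₂ hm₂]
    · ext v
      refine (hadapp _ v).trans ?_
      rw [LieDerivation.lie_apply]
      rw [h₁ (D₂ v), h₂ (D₁ v), hfD, hfD, h₁, h₂, sub_lie, add_lie, smul_lie, smul_lie, lie_add,
        lie_add, lie_smul, lie_smul, ← lie_skew u₁ m₂, ← lie_skew u₂ m₁, hClie hm₁ v, hClie hm₂ v,
        hClie hm₁ u₂, hClie hm₂ u₁, lie_lie]
      module
  have hdisj (u : L) (hu : LieDerivation.ad K L u ∈ center K (LieDerivation K L L)) :
      u ∈ center K L := by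
    have h1 (a b : L) : ⁅b, ⁅a, u⁆⁆ = 0 := by
      rw [mem_maxTrivSubmodule] at hu
      have h0 : LieDerivation.ad K L ⁅a, u⁆ = 0 := by
        rw [LieHom.map_lie]
        exact hu _
      have h := LieDerivation.congr_fun h0 b
      rw [hadapp] at h
      rw [← lie_skew, h]
      simp
    -- From `⁅y, ⁅y, u⁆⁆ = 0` by semisimplicity; by Jacobi `u` also centralizes `[L, L]`, which
    -- contains `ker f`.
    have hyu : ⁅y, u⁆ = 0 := hss.apply_eq_zero_of_apply_apply_eq_zero (h1 y y)
    refine hCZ (fun j hj => ?_) hyu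
    have hj' : j ∈ (derivedSeries K L 1).toSubmodule := hker j hj
    rw [derivedSeries_def, derivedSeriesOfIdeal_succ,
      LieSubmodule.lieIdeal_oper_eq_linear_span'] at hj'
    clear hj
    induction hj' using Submodule.span_induction with
    | mem w hw =>
      obtain ⟨a, -, b, -, rfl⟩ := hw
      have h2 := h1 a b
      have h3 := h1 b a
      rw [leibniz_lie, ← lie_skew u b, ← lie_skew u a, lie_neg, neg_lie, h3, ← lie_skew, h2]
      simp
    | zero => simp
    | add a b _ _ ha hb => rw [lie_add, ha, hb, add_zero]
    | smul c a _ ha => rw [lie_smul, ha, smul_zero]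
  have hcompl : IsCompl (center K (LieDerivation K L L)).toSubmodule (LieDerivation.rangeAd K L) := by
    constructor
    · rw [Submodule.disjoint_def]
      rintro _ h ⟨u, rfl⟩
      have hu := hdisj u h
      rwa [← LieDerivation.ad_ker_eq_center] at hu
    · rw [codisjoint_iff, eq_top_iff]
      intro D _
      obtain ⟨u, m, hm, h⟩ := hdec D
      obtain ⟨c, hc, hmc⟩ := hss.exists_apply_sub_eq_zero (C := C.toSubmodule)
        (fun c hc => lie_mem_right K L C y c hc) hm
      set z := m - ⁅y, c⁆ with hz
      have hzZ : z ∈ center K L := hCZ (sub_mem hm (lie_mem_right K L C y c hc)) hmc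
      have hz0 (w : L) : ⁅w, z⁆ = 0 := (mem_maxTrivSubmodule K L L z).mp hzZ w
      refine Submodule.mem_sup.mpr ⟨D - LieDerivation.ad K L (u - c), ?_,
        LieDerivation.ad K L (u - c), ⟨_, rfl⟩, sub_add_cancel _ _⟩
      have hψ (v : L) : (D - LieDerivation.ad K L (u - c)) v = f v • z := by
        have h1 : (D - LieDerivation.ad K L (u - c)) v = D v - ⁅u - c, v⁆ := by simp
        rw [h1, h, sub_lie, hClie hc, hz, ← lie_skew y c]
        module
      change _ ∈ center K (LieDerivation K L L)
      rw [mem_maxTrivSubmodule]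
      intro D'
      ext v
      obtain ⟨u', m', hm', h'⟩ := hdec D'
      rw [LieDerivation.lie_apply, hψ, hψ, hfD, map_smul, h', hz0, hZf z hzZ]
      simp
  refine center_lieDerivation_eq_bot_of_isCompl hcompl
    (N := (center K (LieDerivation K L L)).toSubmodule ⊔
      (LinearMap.ker f).map (LieDerivation.ad K L : L →ₗ[K] LieDerivation K L L))
    (fun a b => LinearMap.map_le_range (hlie a b)) (fun a b => Submodule.mem_sup_right (hlie a b))
    le_sup_left ?_
  intro htop
  obtain ⟨b, hb, _, ⟨i, hi, rfl⟩, hbi⟩ := Submodule.mem_sup.mp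
    (htop ▸ Submodule.mem_top : LieDerivation.ad K L y ∈ _)
  have h1 : LieDerivation.ad K L (y - i) ∈ center K (LieDerivation K L L) := by
    rw [map_sub, ← hbi]
    simpa using hb
  have h2 := hZf _ (hdisj _ h1)
  rw [map_sub, hfy, LinearMap.mem_ker.mp hi, sub_zero] at h2
  exact one_ne_zero h2

/-- If the radical is not nilpotent, the center is nonzero and there are not more derivations than
elements, then the second derivation algebra has trivial center. -/
theorem HasNonNilpotentRadical.center_lieDerivation_lieDerivation_eq_bot
    (hR : HasNonNilpotentRadical K L) (hZ : center K L ≠ ⊥)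
    (hdim : finrank K (LieDerivation K L L) ≤ finrank K L) :
    center K (LieDerivation K (LieDerivation K L L) (LieDerivation K L L)) = ⊥ := by
  obtain ⟨x, hxR, hx⟩ := hasNonNilpotentRadical_iff.mp hR
  obtain ⟨f, hf, y, hfy, hss, hker, hCf, hsup⟩ :=
    exists_isSemisimple_ad_of_finrank_lieDerivation_le hxR hx hZ hdim
  exact center_lieDerivation_lieDerivation_eq_bot_of_isSemisimple hf hfy hss hker hCf hsup

end

/-! ### The derivation tower. -/

section

variable (K : Type u) [Field K] (g : Type v) [LieRing g] [LieAlgebra K g]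

instance DerivationTower.finiteDimensional [FiniteDimensional K g] (n : ℕ) :
    FiniteDimensional K (DerivationTower K g n) := by
  induction n with
  | zero => exact inferInstanceAs (FiniteDimensional K g)
  | succ n ih =>
    exact inferInstanceAs
      (FiniteDimensional K (LieDerivation K (DerivationTower K g n) (DerivationTower K g n)))

/-- The adjoint representation, as a map from one step of the tower to the next. -/
def DerivationTower.ad (n : ℕ) : DerivationTower K g n →ₗ⁅K⁆ DerivationTower K g (n + 1) :=
  LieDerivation.ad K (DerivationTower K g n)

variable {K g}

theorem DerivationTower.injective_ad {n : ℕ} (h : center K (DerivationTower K g n) = ⊥) :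
    Function.Injective (DerivationTower.ad K g n) :=
  LieDerivation.injective_ad_of_center_eq_bot h

/-- The subalgebra is the image of `gₙ` under the iterated adjoint maps. The bound on its dimension
does not depend on `k`, which is what bounds the tower. -/
theorem DerivationTower.exists_isSubnormalCentralizing [FiniteDimensional K g] {n : ℕ}
    (h : center K (DerivationTower K g n) = ⊥) (k : ℕ) :
    ∃ H : LieSubalgebra K (DerivationTower K g (n + k)), H.IsSubnormalCentralizing ∧
      finrank K H ≤ finrank K (DerivationTower K g n) := by
  induction k with
  | zero =>
    exact ⟨⊤, LieSubalgebra.isSubnormalCentralizing_top h, Submodule.finrank_le _⟩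
  | succ k ih =>
    obtain ⟨H, hH, hdim⟩ := ih
    exact ⟨H.map (DerivationTower.ad K g (n + k)), hH.map_ad,
      (Submodule.finrank_map_le _ H.toSubmodule).trans hdim⟩

theorem DerivationTower.center_eq_bot_of_le [FiniteDimensional K g] {n m : ℕ}
    (h : center K (DerivationTower K g n) = ⊥) (hm : n ≤ m) :
    center K (DerivationTower K g m) = ⊥ := by
  obtain ⟨k, rfl⟩ := Nat.exists_eq_add_of_le hm
  obtain ⟨H, hH, -⟩ := exists_isSubnormalCentralizing h k
  exact hH.center_eq_bot

/-- If some step of the tower has trivial center, then the tower is of type 1. -/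
theorem isTowerOfType1_of_center_eq_bot [FiniteDimensional K g] {n : ℕ}
    (h : center K (DerivationTower K g n) = ⊥) : IsTowerOfType1 K g := by
  let d (k : ℕ) : ℕ := finrank K (DerivationTower K g (n + k))
  have hmono : Monotone d := monotone_nat_of_le_succ fun k =>
    LinearMap.finrank_le_finrank_of_injective
      (f := (DerivationTower.ad K g (n + k) : DerivationTower K g (n + k) →ₗ[K] _))
      (DerivationTower.injective_ad (DerivationTower.center_eq_bot_of_le h (Nat.le_add_right n k)))
  have hbound (k : ℕ) : d k ≤ d 0 ^ 2 + d 0 := by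
    obtain ⟨H, hH, hdim⟩ := DerivationTower.exists_isSubnormalCentralizing h k
    exact hH.finrank_le.trans (add_le_add (Nat.pow_le_pow_left hdim 2) hdim)
  obtain ⟨N, hN⟩ : ∃ N, ∀ k, N ≤ k → d k = d N := by
    obtain ⟨_, ⟨N, rfl⟩, hmax⟩ := Set.Finite.exists_maximal
      (s := Set.range d) ((Set.finite_Iic (d 0 ^ 2 + d 0)).subset
        (by rintro _ ⟨k, rfl⟩; exact hbound k)) ⟨_, 0, rfl⟩
    exact ⟨N, fun k hk => le_antisymm (hmax ⟨k, rfl⟩ (hmono hk)) (hmono hk)⟩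
  have hbij (k : ℕ) (hk : N ≤ k) : Function.Bijective (DerivationTower.ad K g (n + k)) := by
    have hinj := DerivationTower.injective_ad
      (DerivationTower.center_eq_bot_of_le h (Nat.le_add_right n k))
    refine ⟨hinj, ?_⟩
    have hd : finrank K (DerivationTower K g (n + k)) =
        finrank K (DerivationTower K g (n + k + 1)) :=
      (hN k hk).trans (hN (k + 1) (by omega)).symm
    exact (LinearMap.injective_iff_surjective_of_finrank_eq_finrank
      (f := (DerivationTower.ad K g (n + k) : DerivationTower K g (n + k) →ₗ[K] _)) hd).mp hinj
  refine ⟨⟨n, fun m hm => DerivationTower.center_eq_bot_of_le h hm⟩,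
    derivationTowerBundled K g (n + N), ⟨n + N, fun m hm => ?_⟩,
    DerivationTower.center_eq_bot_of_le h (Nat.le_add_right n N), fun D => ?_⟩
  · obtain ⟨k, rfl⟩ := Nat.exists_eq_add_of_le hm
    induction k with
    | zero => exact ⟨LieEquiv.refl⟩
    | succ k ih =>
      obtain ⟨e⟩ := ih (Nat.le_add_right _ _)
      have hb := hbij (N + k) (Nat.le_add_right N k)
      rw [← add_assoc] at hb
      exact ⟨(LieEquiv.ofBijective (DerivationTower.ad K g (n + N + k)) hb).symm.trans e⟩
  · obtain ⟨x, hx⟩ := (hbij N le_rfl).2 D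
    exact ⟨x, hx.symm⟩

theorem DerivationTower.hasNonNilpotentRadical_of_le [CharZero K] [FiniteDimensional K g] {p n : ℕ}
    (hp : HasNonNilpotentRadical K (DerivationTower K g p)) (hn : p ≤ n) :
    HasNonNilpotentRadical K (DerivationTower K g n) := by
  induction n, hn using Nat.le_induction with
  | base => exact hp
  | succ n _ ih => exact ih.lieDerivation

/-- If all centers in the tower are nonzero, then the dimensions do not decrease. -/
theorem DerivationTower.monotone_finrank [FiniteDimensional K g]
    (h : ∀ n, center K (DerivationTower K g n) ≠ ⊥) :
    Monotone fun n => finrank K (DerivationTower K g n) :=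
  monotone_nat_of_le_succ fun n => finrank_le_finrank_lieDerivation fun hn =>
    h (n + 1) (center_lieDerivation_eq_bot_of_perfect hn)

/-- If all centers in the tower are nonzero and some radical is not nilpotent, then the dimensions
increase strictly from that step on. -/
theorem DerivationTower.finrank_lt_finrank_succ [CharZero K] [FiniteDimensional K g]
    (h : ∀ n, center K (DerivationTower K g n) ≠ ⊥) {n : ℕ}
    (hn : HasNonNilpotentRadical K (DerivationTower K g n)) :
    finrank K (DerivationTower K g n) < finrank K (DerivationTower K g (n + 1)) := by
  by_contra hlt
  exact h (n + 2) (hn.center_lieDerivation_lieDerivation_eq_bot (h n) (not_lt.mp hlt))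

theorem DerivationTower.tendsto_finrank [CharZero K] [FiniteDimensional K g]
    (h : ∀ n, center K (DerivationTower K g n) ≠ ⊥) {p : ℕ}
    (hp : HasNonNilpotentRadical K (DerivationTower K g p)) :
    Filter.Tendsto (fun n => finrank K (DerivationTower K g n)) Filter.atTop Filter.atTop := by
  rw [← Filter.tendsto_add_atTop_iff_nat p]
  refine StrictMono.tendsto_atTop (strictMono_nat_of_lt_succ fun n => ?_)
  rw [Nat.add_right_comm]
  exact finrank_lt_finrank_succ h (hasNonNilpotentRadical_of_le hp (Nat.le_add_left p n))

/-- A tower which terminates does not have dimensions tending to infinity. -/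
theorem TowerTerminatesAt.not_tendsto_finrank {L : Type v} [LieRing L] [LieAlgebra K L]
    (h : TowerTerminatesAt K g L) :
    ¬ Filter.Tendsto (fun n => finrank K (DerivationTower K g n)) Filter.atTop Filter.atTop := by
  intro ht
  obtain ⟨N, hN⟩ := h
  obtain ⟨M, hM⟩ := Filter.eventually_atTop.mp (ht.eventually_gt_atTop (finrank K L))
  obtain ⟨e⟩ := hN (max N M) (le_max_left N M)
  exact (hM _ (le_max_right N M)).ne' e.toLinearEquiv.finrank_eq

end

theorem mainTheorem10 {K : Type u} [Field K] [CharZero K]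
    (g : Type v) [LieRing g] [LieAlgebra K g] [FiniteDimensional K g]
    (p : ℕ) (hp : HasNonNilpotentRadical K (DerivationTower K g p)) :
    (∀ n ≥ p, HasNonNilpotentRadical K (DerivationTower K g n)) ∧
    (IsTowerOfType1 K g ∨ IsTowerOfType3 K g) ∧
    ¬ IsTowerOfType2 K g ∧
    (IsTowerOfType3 K g → ∀ n ≥ p,
      Module.finrank K (DerivationTower K g n) <
        Module.finrank K (DerivationTower K g (n + 1))) := by
  have hrad : ∀ n ≥ p, HasNonNilpotentRadical K (DerivationTower K g n) :=
    fun n hn => DerivationTower.hasNonNilpotentRadical_of_le hp hn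
  refine ⟨hrad, ?_, ?_, ?_⟩
  · by_cases h : ∀ n, center K (DerivationTower K g n) ≠ ⊥
    · exact Or.inr ⟨DerivationTower.monotone_finrank h, DerivationTower.tendsto_finrank h hp⟩
    · push Not at h
      obtain ⟨n, hn⟩ := h
      exact Or.inl (isTowerOfType1_of_center_eq_bot hn)
  · rintro ⟨h, L, hL, -⟩
    exact hL.not_tendsto_finrank (DerivationTower.tendsto_finrank h hp)
  · intro h3 n hn
    -- A vanishing center would make the tower terminate, against the divergence of the dimensions.
    refine DerivationTower.finrank_lt_finrank_succ (fun m hm => ?_) (hrad n hn)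
    obtain ⟨-, L, hL, -⟩ := isTowerOfType1_of_center_eq_bot hm
    exact hL.not_tendsto_finrank h3.2
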